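/- Let $-1<q<1$ and let $\mathcal H$ be a real Hilbert space. Let $\Gamma_q$ be its $q$-Fock space: the Hilbert space completion of the complex span of the vacuum $\Phi$ and the elementary tensors $f_1\otimes\dots\otimes f_n$ ($f_i\in\mathcal H$, $n\ge1$) in the scalar product $$\langle f_1\otimes\dots\otimes f_n\,|\,g_1\otimes\dots\otimes g_m\rangle_q=\delta_{n,m}\sum_{\sigma\in S_n}q^{|\sigma|}\prod_{j=1}^n\langle f_j,g_{\sigma(j)}\rangle ,$$ where $|\sigma|$ is the number of inversions of $\sigma$ and $\Phi$ is the tensor with no factors. For $f\in\mathcal H$ let $\mathbf a_f,\mathbf a_f^*$ be the bounded operators on $\Gamma_q$ with $$\mathbf a_f\Phi=0,\qquad \mathbf a_f\, f_1\otimes\dots\otimes f_n=\sum_{j=1}^n q^{j-1}\langle f,f_j\rangle\, f_1\otimes\dots\otimes f_{j-1}\otimes f_{j+1}\otimes\dots\otimes f_n,\qquad \mathbf a_f^*\Phi=f,\quad \mathbf a_f^*\, f_1\otimes\dots\otimes f_n=f\otimes f_1\otimes\dots\otimes f_n,$$ and put $\mathbf X_f=\mathbf a_f+\mathbf a_f^*$.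 Let $\mathcal A$ be the algebra of operators generated by the identity $\mathbf I$ and all $\mathbf X_f$, $f\in\mathcal H$, with the vacuum expectation $\mathbb E(\mathbf X)=\langle\Phi|\mathbf X\Phi\rangle_q$. A conditional expectation with respect to a subalgebra $\mathcal B\subset\mathcal A$ is a mapping $\mathcal E:\mathcal A\to\mathcal B$ such that $\mathbb E(\mathbf Y_1\mathbf X\mathbf Y_2)=\mathbb E(\mathbf Y_1\mathcal E(\mathbf X)\mathbf Y_2)$ for all $\mathbf X\in\mathcal A$ and $\mathbf Y_1,\mathbf Y_2\in\mathcal B$. **1.** Let $k\ge0$, $f_0,f_1,\dots,f_k\in\mathcal H$, $\mathbf X_j=\mathbf X_{f_j}$, let $\mathcal B$ be the subalgebra generated by $\mathbf I,\mathbf X_1,\dots,\mathbf X_k$, and let $P$ be the orthogonal projection of $\mathcal H$ onto the span of $f_1,\dots,f_k$. There is exactly one conditional expectation $\mathbb E(\,\cdot\,|\mathbf X_1,\dots,\mathbf X_k):\mathcal A\to\mathcal B$. There are real $a_1,\dots,a_k$ with $Pf_0=\sum_j a_jf_j$, and for every such choice, with $c=\|f_0\|^2-\|Pf_0\|^2$,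 $$\mathbb E(\mathbf X_0|\mathbf X_1,\dots,\mathbf X_k)=\sum_{j=1}^k a_j\mathbf X_j,\qquad \mathbb E(\mathbf X_0^2|\mathbf X_1,\dots,\mathbf X_k)=\Big(\sum_{j=1}^k a_j\mathbf X_j\Big)^2+c\,\mathbf I,$$ $$\mathbb E\Big(\big(\mathbf X_0-\mathbb E(\mathbf X_0|\mathbf X_1,\dots,\mathbf X_k)\big)^2\Big|\mathbf X_1,\dots,\mathbf X_k\Big)=c\,\mathbf I .$$ The same formulas hold for the von Neumann algebra $\mathcal M$ generated by $\mathbf X_1,\dots,\mathbf X_k$: for $\mathbf X=\mathbf X_0$, $\mathbf X=\mathbf X_0^2$ and $\mathbf X=(\mathbf X_0-\sum_j a_j\mathbf X_j)^2$ the corresponding right-hand side is the unique $\mathbf Z\in\mathcal M$ such that $\mathbb E(\mathbf Y_1\mathbf X\mathbf Y_2)=\mathbb E(\mathbf Y_1\mathbf Z\mathbf Y_2)$ for all $\mathbf Y_1,\mathbf Y_2\in\mathcal M$. **2.** If moreover $f_1,\dots,f_k$ are linearly independent, then the coefficients are uniquely determined by the covariance matrix $C=[\langle f_i,f_j\rangle]_{0\le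 i,j\le k}$: for each $k$ there is a function of $C$ alone (the same for all $\mathcal H$ and $q$) with real values $(a_1,\dots,a_k,c)$ such that these values are the only complex numbers satisfying the two equations $\mathbb E(\mathbf X_0|\mathbf X_1,\dots,\mathbf X_k)=\sum_j a_j\mathbf X_j$ and $\mathbb E(\mathbf X_0^2|\mathbf X_1,\dots,\mathbf X_k)=(\sum_j a_j\mathbf X_j)^2+c\,\mathbf I$. **3.** Let $f,g,h\in\mathcal H$, where $f,h$ are linearly independent unit vectors, and put $\mathbf X=\mathbf X_f$, $\mathbf Y=\mathbf X_g$, $\mathbf Z=\mathbf X_h$. Then $$\mathbb E(\mathbf Y|\mathbf X,\mathbf Z)=a\mathbf X+b\mathbf Z,\qquad \mathbb E(\mathbf Y^2|\mathbf X,\mathbf Z)=(a\mathbf X+b\mathbf Z)^2+c\,\mathbf I,$$ where $$a=\frac{\langle f,g\rangle-\langle g,h\rangle\langle f,h\rangle}{1-\langle f,h\rangle^2},\qquad b=\frac{\langle g,h\rangle-\langle f,g\rangle\langle f,h\rangle}{1-\langle f,h\rangle^2},\qquad c=\frac{\det C}{1-\langle f,h\rangle^2},$$ $C$ is the $3\times3$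 matrix of the scalar products of $f,g,h$; here $c=\|g\|^2-\|P'g\|^2\ge0$, with $P'$ the orthogonal projection onto the span of $f,h$. -/

import Mathlib

universe u

open scoped ComplexConjugate

noncomputable section

namespace QGauss

/-- Number of inversions `#{(i, j) : i < j, σ i > σ j}`. -/
def inversions {n m : ℕ} (σ : Fin n ≃ Fin m) : ℕ :=
  (Finset.univ.filter fun p : Fin n × Fin n => p.1 < p.2 ∧ σ p.2 < σ p.1).card

/-- A word `f₁ ⊗ ⋯ ⊗ fₙ` with letters in `H`; the empty word is the vacuum. -/
abbrev Word (H : Type u) : Type u := Σ n : ℕ, Fin n → H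

variable {H : Type u} [NormedAddCommGroup H] [InnerProductSpace ℝ H]

/-- The `q`-scalar product `∑_σ q^|σ| ∏ⱼ ⟨fⱼ, g_{σ(j)}⟩` of the words `f₁ ⊗ ⋯ ⊗ fₙ` and
`g₁ ⊗ ⋯ ⊗ gₘ`. The sum runs over all bijections `{1, …, n} → {1, …, m}`, so it is empty, and the
scalar product is `0`, if `n ≠ m`. -/
def wordInner (q : ℝ) (v w : Word H) : ℝ :=
  ∑ σ : Fin v.1 ≃ Fin w.1, q ^ inversions σ * ∏ j, inner ℝ (v.2 j) (w.2 (σ j))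

theorem inversions_symm {n m : ℕ} (σ : Fin n ≃ Fin m) :
    inversions σ.symm = inversions σ := by
  refine Finset.card_bij' (fun p _ => (σ.symm p.2, σ.symm p.1)) (fun p _ => (σ p.2, σ p.1))
    ?_ ?_ ?_ ?_ <;> simp +contextual

theorem wordInner_comm (q : ℝ) (v w : Word H) : wordInner q v w = wordInner q w v := by
  unfold wordInner
  refine Fintype.sum_equiv ⟨Equiv.symm, Equiv.symm, fun _ => rfl, fun _ => rfl⟩ _ _ fun σ => ?_
  simp only [Equiv.coe_fn_mk, inversions_symm]
  congr 1
  refine Fintype.prod_equiv σ _ _ fun j => ?_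
  simp [real_inner_comm]

theorem posSemidef_prod {ι κ : Type*} (S : Finset κ) (A : κ → Matrix ι ι ℝ)
    (hA : ∀ p ∈ S, (A p).PosSemidef) [Finite ι] :
    (Matrix.of fun i j => ∏ p ∈ S, A p i j).PosSemidef := by
  classical
  induction S using Finset.induction_on with
  | empty =>
    have := Matrix.posSemidef_gram ℝ (fun _ : ι => (1 : ℝ))
    have e : (Matrix.of fun i j => ∏ p ∈ (∅ : Finset κ), A p i j) =
        Matrix.gram ℝ (fun _ : ι => (1 : ℝ)) := by
      ext i j
      simp [Matrix.gram]
    rw [e]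
    exact this
  | insert p S hp ih =>
    have h1 := (hA p (by simp)).hadamard (ih fun p' h => hA p' (by simp [h]))
    have e : (Matrix.of fun i j => ∏ p ∈ insert p S, A p i j) =
        (A p).hadamard (Matrix.of fun i j => ∏ p ∈ S, A p i j) := by
      ext i j
      simp [Finset.prod_insert hp]
    rw [e]
    exact h1

theorem posSemidef_two {ι : Type*} [Finite ι] {q : ℝ} (h1 : -1 ≤ q) (h2 : q ≤ 1)
    (P : ι → Prop) [DecidablePred P] :
    (Matrix.of fun i j : ι => if (P i ↔ P j) then (1 : ℝ) else q).PosSemidef := by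
  have hA := (Matrix.posSemidef_gram ℝ (fun _ : ι => (1 : ℝ))).smul
    (show (0 : ℝ) ≤ (1 + q) / 2 by linarith)
  have hB := (Matrix.posSemidef_gram ℝ (fun i : ι => if P i then (1 : ℝ) else -1)).smul
    (show (0 : ℝ) ≤ (1 - q) / 2 by linarith)
  have e : (Matrix.of fun i j : ι => if (P i ↔ P j) then (1 : ℝ) else q) =
      ((1 + q) / 2) • Matrix.gram ℝ (fun _ : ι => (1 : ℝ)) +
        ((1 - q) / 2) • Matrix.gram ℝ (fun i : ι => if P i then (1 : ℝ) else -1) := by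
    ext i j
    by_cases hi : P i <;> by_cases hj : P j <;> simp [Matrix.gram, hi, hj] <;> ring
  rw [e]
  exact hA.add hB

theorem pow_inversions (q : ℝ) {N n m : ℕ} (σ : Fin N ≃ Fin n) (τ : Fin N ≃ Fin m) :
    q ^ inversions (σ.symm.trans τ) =
      ∏ p ∈ Finset.univ.filter (fun p : Fin N × Fin N => p.1 < p.2),
        if (σ p.1 < σ p.2 ↔ τ p.1 < τ p.2) then (1 : ℝ) else q := by
  have h1 : inversions (σ.symm.trans τ) =
      ((Finset.univ.filter (fun p : Fin N × Fin N => p.1 < p.2)).filter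
        fun p => ¬ (σ p.1 < σ p.2 ↔ τ p.1 < τ p.2)).card := by
    have h0 : inversions (σ.symm.trans τ) = (Finset.univ.filter fun p : Fin n × Fin n =>
        p.1 < p.2 ∧ τ (σ.symm p.2) < τ (σ.symm p.1)).card := rfl
    rw [h0]
    refine Finset.card_bij'
      (fun p _ => if σ.symm p.1 < σ.symm p.2 then (σ.symm p.1, σ.symm p.2)
        else (σ.symm p.2, σ.symm p.1))
      (fun p _ => if σ p.1 < σ p.2 then (σ p.1, σ p.2) else (σ p.2, σ p.1)) ?_ ?_ ?_ ?_
    · rintro ⟨a, b⟩ h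
      obtain ⟨a, rfl⟩ := σ.surjective a
      obtain ⟨b, rfl⟩ := σ.surjective b
      simp only [Finset.mem_filter, Finset.mem_univ, true_and,
        Equiv.symm_apply_apply] at h ⊢
      have hab : a ≠ b := by rintro rfl; exact lt_irrefl _ h.1
      split_ifs with hc
      · exact ⟨hc, by simp [h.1, h.2.le]⟩
      · exact ⟨lt_of_le_of_ne (not_lt.1 hc) hab.symm, by simp [h.1.le, h.2]⟩
    · rintro ⟨a, b⟩ h
      simp only [Finset.mem_filter, Finset.mem_univ, true_and] at h ⊢
      have hab : a ≠ b := h.1.ne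
      have hs : σ a ≠ σ b := σ.injective.ne hab
      have ht : τ a ≠ τ b := τ.injective.ne hab
      have h2 := h.2
      split_ifs with hc
      · simp only [Equiv.symm_apply_apply]
        simp only [hc, true_iff, not_lt] at h2
        exact ⟨hc, lt_of_le_of_ne h2 ht.symm⟩
      · simp only [Equiv.symm_apply_apply]
        simp only [hc, false_iff, not_not] at h2
        exact ⟨lt_of_le_of_ne (not_lt.1 hc) hs.symm, h2⟩
    · rintro ⟨a, b⟩ h
      obtain ⟨a, rfl⟩ := σ.surjective a
      obtain ⟨b, rfl⟩ := σ.surjective b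
      simp only [Finset.mem_filter, Finset.mem_univ, true_and] at h
      by_cases hc : a < b
      · simp [hc, h.1]
      · simp [hc, h.1.le]
    · rintro ⟨a, b⟩ h
      simp only [Finset.mem_filter, Finset.mem_univ, true_and] at h
      by_cases hc : σ a < σ b
      · simp [hc, h.1]
      · simp [hc, h.1.le]
  rw [h1, Finset.prod_ite]
  simp

/-- The `q`-scalar product is nonnegative definite for `-1 ≤ q ≤ 1`. -/
theorem wordInner_pos (q : ℝ) (h1 : -1 ≤ q) (h2 : q ≤ 1) (s : Finset (Word H)) (c : Word H → ℝ) :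
    0 ≤ ∑ v ∈ s, ∑ w ∈ s, c v * c w * wordInner q v w := by
  classical
  set M := s.sup (fun v => v.1) + 1 with hM
  let G : (N : ℕ) → Matrix (Σ v : s, (Fin N ≃ Fin v.1.1)) (Σ v : s, (Fin N ≃ Fin v.1.1)) ℝ :=
    fun N => Matrix.of fun a b => q ^ inversions (a.2.symm.trans b.2) *
      ∏ j, inner ℝ (a.1.1.2 (a.2 j)) (b.1.1.2 (b.2 j))
  have hG : ∀ N, (G N).PosSemidef := by
    intro N
    have hA := posSemidef_prod (Finset.univ.filter (fun p : Fin N × Fin N => p.1 < p.2))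
      (fun p => Matrix.of fun a b : (Σ v : s, (Fin N ≃ Fin v.1.1)) =>
        if (a.2 p.1 < a.2 p.2 ↔ b.2 p.1 < b.2 p.2) then (1 : ℝ) else q)
      (fun p _ => posSemidef_two h1 h2
        (fun a : (Σ v : s, (Fin N ≃ Fin v.1.1)) => a.2 p.1 < a.2 p.2))
    have hB := posSemidef_prod (Finset.univ : Finset (Fin N))
      (fun j => Matrix.gram ℝ fun a : (Σ v : s, (Fin N ≃ Fin v.1.1)) => a.1.1.2 (a.2 j))
      (fun p _ => Matrix.posSemidef_gram ℝ _)
    have e := hA.hadamard hB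
    refine Eq.mp (congrArg _ ?_) e
    ext a b
    simp [G, pow_inversions, Matrix.gram]
  have key : ∀ v ∈ s, ∀ w : Word H, wordInner q v w =
      ∑ N ∈ Finset.range M, ((N.factorial : ℝ)⁻¹) *
        ∑ σ : Fin N ≃ Fin v.1, ∑ τ : Fin N ≃ Fin w.1,
          q ^ inversions (σ.symm.trans τ) * ∏ j, inner ℝ (v.2 (σ j)) (w.2 (τ j)) := by
    intro v hv w
    have hvM : v.1 ∈ Finset.range M := by
      rw [Finset.mem_range, hM]
      exact Nat.lt_succ_of_le (Finset.le_sup (f := fun v : Word H => v.1) hv)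
    rw [Finset.sum_eq_single_of_mem v.1 hvM]
    · have : ∀ σ : Fin v.1 ≃ Fin v.1, (∑ τ : Fin v.1 ≃ Fin w.1,
          q ^ inversions (σ.symm.trans τ) * ∏ j, inner ℝ (v.2 (σ j)) (w.2 (τ j)))
          = wordInner q v w := by
        intro σ
        unfold wordInner
        refine Fintype.sum_equiv
          ⟨fun τ => σ.symm.trans τ, fun τ => σ.trans τ, fun τ => by ext; simp,
            fun τ => by ext; simp⟩ _ _ fun τ => ?_
        simp only [Equiv.coe_fn_mk]
        congr 1
        refine Fintype.prod_equiv σ _ _ fun j => ?_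
        simp
      simp only [this, Finset.sum_const, Finset.card_univ, nsmul_eq_mul]
      rw [Fintype.card_equiv (Equiv.refl _), Fintype.card_fin, ← mul_assoc,
        inv_mul_cancel₀ (by exact_mod_cast Nat.factorial_ne_zero _), one_mul]
    · intro N _ hN
      have : IsEmpty (Fin N ≃ Fin v.1) :=
        ⟨fun σ => hN (by simpa using Fintype.card_congr σ)⟩
      simp
  have hpos : ∀ N, 0 ≤ ∑ v ∈ s, ∑ w ∈ s, c v * c w *
      ∑ σ : Fin N ≃ Fin v.1, ∑ τ : Fin N ≃ Fin w.1,
          q ^ inversions (σ.symm.trans τ) * ∏ j, inner ℝ (v.2 (σ j)) (w.2 (τ j)) := by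
    intro N
    have h := (hG N).dotProduct_mulVec_nonneg (fun a => c a.1.1)
    refine h.trans_eq ?_
    simp only [dotProduct, Matrix.mulVec, Pi.star_apply, star_trivial, G, Matrix.of_apply,
      Fintype.sum_sigma, Finset.mul_sum]
    rw [← Finset.sum_attach s]
    refine Finset.sum_congr (by rfl) fun v _ => ?_
    rw [← Finset.sum_attach s, Finset.sum_comm]
    refine Finset.sum_congr (by rfl) fun w _ => ?_
    refine Finset.sum_congr rfl fun σ _ => ?_
    refine Finset.sum_congr rfl fun τ _ => ?_
    ring
  have : ∑ v ∈ s, ∑ w ∈ s, c v * c w * wordInner q v w =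
      ∑ N ∈ Finset.range M, ((N.factorial : ℝ)⁻¹) * ∑ v ∈ s, ∑ w ∈ s, c v * c w *
      ∑ σ : Fin N ≃ Fin v.1, ∑ τ : Fin N ≃ Fin w.1,
          q ^ inversions (σ.symm.trans τ) * ∏ j, inner ℝ (v.2 (σ j)) (w.2 (τ j)) := by
    have e : ∑ v ∈ s, ∑ w ∈ s, c v * c w * wordInner q v w =
        ∑ v ∈ s, ∑ w ∈ s, ∑ N ∈ Finset.range M, ((N.factorial : ℝ)⁻¹) * (c v * c w *
        ∑ σ : Fin N ≃ Fin v.1, ∑ τ : Fin N ≃ Fin w.1,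
          q ^ inversions (σ.symm.trans τ) * ∏ j, inner ℝ (v.2 (σ j)) (w.2 (τ j))) := by
      refine Finset.sum_congr rfl fun v hv => Finset.sum_congr rfl fun w _ => ?_
      rw [key v hv w, Finset.mul_sum]
      exact Finset.sum_congr rfl fun N _ => by ring
    rw [e]
    simp only [Finset.mul_sum]
    rw [Finset.sum_congr rfl fun v _ => Finset.sum_comm, Finset.sum_comm]
  rw [this]
  exact Finset.sum_nonneg fun N _ => mul_nonneg (by positivity) (hpos N)

/-- The bijection sending `0` to `j` and acting as `τ` between the remaining elements. -/
def insertZero {n m : ℕ} (j : Fin (m + 1)) (τ : Fin n ≃ Fin m) : Fin (n + 1) ≃ Fin (m + 1) :=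
  (finSuccEquiv' 0).trans ((Equiv.optionCongr τ).trans (finSuccEquiv' j).symm)

theorem insertZero_zero {n m : ℕ} (j : Fin (m + 1)) (τ : Fin n ≃ Fin m) :
    insertZero j τ 0 = j := by
  simp [insertZero]

theorem insertZero_succ {n m : ℕ} (j : Fin (m + 1)) (τ : Fin n ≃ Fin m) (i : Fin n) :
    insertZero j τ i.succ = j.succAbove (τ i) := by
  have h := finSuccEquiv'_succAbove (0 : Fin (n + 1)) i
  rw [Fin.zero_succAbove] at h
  simp [insertZero, h]

theorem insertZero_bijective (n m : ℕ) : Function.Bijective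
    (fun p : Fin (m + 1) × (Fin n ≃ Fin m) => insertZero p.1 p.2) := by
  rw [Fintype.bijective_iff_injective_and_card]
  constructor
  · rintro ⟨j, τ⟩ ⟨j', τ'⟩ h
    have h0 : j = j' := by
      have := congrArg (fun σ => σ 0) h
      simpa [insertZero_zero] using this
    subst h0
    have h1 : τ = τ' := by
      ext i
      have := congrArg (fun σ => σ i.succ) h
      simp only [insertZero_succ] at this
      rw [Fin.succAbove_right_injective this]
    rw [h1]
  · by_cases hnm : n = m
    · subst hnm
      rw [Fintype.card_prod, Fintype.card_equiv (Equiv.refl _), Fintype.card_equiv (Equiv.refl _),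
        Fintype.card_fin, Fintype.card_fin, Nat.factorial_succ]
    · have h1 : IsEmpty (Fin n ≃ Fin m) := ⟨fun σ => hnm (by simpa using Fintype.card_congr σ)⟩
      have h2 : IsEmpty (Fin (n + 1) ≃ Fin (m + 1)) :=
        ⟨fun σ => hnm (by simpa using Fintype.card_congr σ)⟩
      simp

theorem inversions_insertZero {n m : ℕ} (j : Fin (m + 1)) (τ : Fin n ≃ Fin m) :
    inversions (insertZero j τ) = j + inversions τ := by
  have h : ∀ {n m : ℕ} (σ : Fin n ≃ Fin m), inversions σ =
      ∑ a, ∑ b, if a < b ∧ σ b < σ a then 1 else 0 := by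
    intro n m σ
    rw [inversions, Finset.card_filter, Fintype.sum_prod_type]
  rw [h, h, Fin.sum_univ_succ]
  congr 1
  · rw [Fin.sum_univ_succ]
    simp only [lt_self_iff_false, false_and, if_false, zero_add, insertZero_zero,
      insertZero_succ, Fin.succ_pos, true_and]
    rw [Fintype.sum_equiv τ _ (fun i => if j.succAbove i < j then 1 else 0) (fun _ => rfl)]
    have : ∀ i : Fin m, (j.succAbove i < j) ↔ (i : ℕ) < j := by
      intro i
      rw [Fin.succAbove_lt_iff_castSucc_lt, Fin.lt_def, Fin.val_castSucc]
    simp only [this]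
    rw [Finset.sum_boole, Nat.cast_id]
    have hj : (j : ℕ) ≤ m := Nat.lt_succ_iff.1 j.2
    rw [Fin.card_filter_val_lt, min_eq_right hj]
  · refine Finset.sum_congr rfl fun a _ => ?_
    rw [Fin.sum_univ_succ]
    simp [insertZero_succ]

theorem wordInner_cons_nil (q : ℝ) (f : H) {n : ℕ} (v : Fin n → H) (w : Fin 0 → H) :
    wordInner q ⟨n + 1, Fin.cons f v⟩ ⟨0, w⟩ = 0 := by
  have : IsEmpty (Fin (n + 1) ≃ Fin 0) := ⟨fun σ => (σ 0).elim0⟩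
  simp [wordInner]

theorem wordInner_cons (q : ℝ) (f : H) {n m : ℕ} (v : Fin n → H) (w : Fin (m + 1) → H) :
    wordInner q ⟨n + 1, Fin.cons f v⟩ ⟨m + 1, w⟩ =
      ∑ j : Fin (m + 1), q ^ (j : ℕ) * inner ℝ f (w j) *
        wordInner q ⟨n, v⟩ ⟨m, j.removeNth w⟩ := by
  unfold wordInner
  rw [← (insertZero_bijective n m).sum_comp, Fintype.sum_prod_type]
  refine Finset.sum_congr rfl fun j _ => ?_
  rw [Finset.mul_sum]
  refine Finset.sum_congr rfl fun τ _ => ?_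
  simp only [inversions_insertZero, Fin.prod_univ_succ, insertZero_zero, insertZero_succ,
    Fin.cons_zero, Fin.cons_succ, Fin.removeNth, pow_add]
  ring

/-- Formal complex linear combinations of words. With the sesquilinear extension of the `q`-scalar
product this is a semi-inner product space. Elements of norm zero are identified with `0` in the
completion `QFock` below; this includes the relations that make
`(f₁, …, fₙ) ↦ f₁ ⊗ ⋯ ⊗ fₙ` real multilinear, since the `q`-scalar product is real multilinear
in the letters. -/
def PreFock (_q : Set.Ioo (-1 : ℝ) 1) (H : Type u) : Type u := Word H →₀ ℂ

section PreFock

variable (q : Set.Ioo (-1 : ℝ) 1)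

instance : AddCommGroup (PreFock q H) := inferInstanceAs (AddCommGroup (Word H →₀ ℂ))

instance : Module ℂ (PreFock q H) := inferInstanceAs (Module ℂ (Word H →₀ ℂ))

/-- The word `w` as an element of `PreFock q H`. -/
def PreFock.word (w : Word H) : PreFock q H := Finsupp.single w 1

variable {q} in
/-- The coefficients of an element of `PreFock q H`. -/
def PreFock.coeff (ξ : PreFock q H) : Word H →₀ ℂ := ξ

/-- The sesquilinear extension (conjugate linear on the left) of the `q`-scalar product. -/
def preInner (ξ η : PreFock q H) : ℂ :=
  ξ.coeff.sum fun v a => η.coeff.sum fun w b => conj a * b * (wordInner q v w : ℂ)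

theorem preInner_eq_sum (ξ η : PreFock q H) (s t : Finset (Word H))
    (hs : ξ.coeff.support ⊆ s) (ht : η.coeff.support ⊆ t) :
    preInner q ξ η =
      ∑ v ∈ s, ∑ w ∈ t, conj (ξ.coeff v) * η.coeff w *
        (wordInner q v w : ℂ) := by
  unfold preInner
  rw [Finsupp.sum_of_support_subset _ hs _ (by simp [Finsupp.sum])]
  refine Finset.sum_congr rfl fun v _ => ?_
  rw [Finsupp.sum_of_support_subset _ ht _ (by simp)]

instance preCore : PreInnerProductSpace.Core ℂ (PreFock q H) where
  inner := preInner q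
  conj_inner_symm ξ η := by
    rw [preInner_eq_sum q η ξ _ _ subset_rfl subset_rfl,
      preInner_eq_sum q ξ η _ _ subset_rfl subset_rfl, Finset.sum_comm]
    simp only [map_sum, map_mul, Complex.conj_conj, Complex.conj_ofReal]
    refine Finset.sum_congr rfl fun v _ => Finset.sum_congr rfl fun w _ => ?_
    rw [wordInner_comm]
    ring
  re_inner_nonneg ξ := by
    rw [preInner_eq_sum q ξ ξ _ _ subset_rfl subset_rfl]
    have h (c : Word H → ℝ) := wordInner_pos (q : ℝ) q.2.1.le q.2.2.le (ξ.coeff.support) c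
    have h1 := h fun v => (ξ.coeff v).re
    have h2 := h fun v => (ξ.coeff v).im
    refine (add_nonneg h1 h2).trans_eq ?_
    rw [← Finset.sum_add_distrib]
    simp only [← Finset.sum_add_distrib, map_sum]
    refine Finset.sum_congr rfl fun v _ => Finset.sum_congr rfl fun w _ => ?_
    simp
    ring
  add_left ξ η ζ := by
    classical
    rw [preInner_eq_sum q (ξ + η) ζ (ξ.coeff.support ∪ η.coeff.support) _
        Finsupp.support_add subset_rfl,
      preInner_eq_sum q ξ ζ (ξ.coeff.support ∪ η.coeff.support) _
        Finset.subset_union_left subset_rfl,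
      preInner_eq_sum q η ζ (ξ.coeff.support ∪ η.coeff.support) _
        Finset.subset_union_right subset_rfl]
    simp only [← Finset.sum_add_distrib]
    refine Finset.sum_congr rfl fun v _ => Finset.sum_congr rfl fun w _ => ?_
    have : (ξ + η).coeff v = ξ.coeff v + η.coeff v := rfl
    rw [this, map_add]
    ring
  smul_left ξ ζ r := by
    rw [preInner_eq_sum q (r • ξ) ζ _ _ Finsupp.support_smul subset_rfl,
      preInner_eq_sum q ξ ζ _ _ subset_rfl subset_rfl]
    simp only [Finset.mul_sum]
    refine Finset.sum_congr rfl fun v _ => Finset.sum_congr rfl fun w _ => ?_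
    have : (r • ξ).coeff v = r * ξ.coeff v := rfl
    rw [this, map_mul]
    ring

instance : SeminormedAddCommGroup (PreFock q H) :=
  InnerProductSpace.Core.toSeminormedAddCommGroup (𝕜 := ℂ)

instance : InnerProductSpace ℂ (PreFock q H) := InnerProductSpace.ofCore (preCore q)

theorem inner_word (v w : Word H) :
    inner ℂ (PreFock.word q v) (PreFock.word q w) = (wordInner q v w : ℂ) := by
  change preInner q _ _ = _
  unfold preInner PreFock.word PreFock.coeff
  rw [Finsupp.sum_single_index (by simp), Finsupp.sum_single_index (by simp)]
  simp

/-- `f₁ ⊗ ⋯ ⊗ fₙ ↦ f ⊗ f₁ ⊗ ⋯ ⊗ fₙ`, extended linearly. -/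
def preCreation (f : H) : PreFock q H →ₗ[ℂ] PreFock q H :=
  Finsupp.linearCombination ℂ fun w : Word H => PreFock.word q ⟨w.1 + 1, Fin.cons f w.2⟩

/-- `Φ ↦ 0` and `f₁ ⊗ ⋯ ⊗ fₙ ↦ ∑ⱼ q^(j-1) ⟨f, fⱼ⟩ f₁ ⊗ ⋯ ⊗ fⱼ₋₁ ⊗ fⱼ₊₁ ⊗ ⋯ ⊗ fₙ`. -/
def wordAnnihilation (f : H) : Word H → PreFock q H
  | ⟨0, _⟩ => 0
  | ⟨n + 1, w⟩ => ∑ j : Fin (n + 1),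
      (((q : ℝ) ^ (j : ℕ) * inner ℝ f (w j) : ℝ) : ℂ) • PreFock.word q ⟨n, j.removeNth w⟩

/-- The linear extension of `wordAnnihilation`. -/
def preAnnihilation (f : H) : PreFock q H →ₗ[ℂ] PreFock q H :=
  Finsupp.linearCombination ℂ (wordAnnihilation q f)

set_option linter.unusedSectionVars false in
theorem preCreation_word (f : H) (w : Word H) :
    preCreation q f (PreFock.word q w) = PreFock.word q ⟨w.1 + 1, Fin.cons f w.2⟩ := by
  unfold preCreation
  exact (Finsupp.linearCombination_single ℂ 1 w).trans (one_smul _ _)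

theorem preAnnihilation_word (f : H) (w : Word H) :
    preAnnihilation q f (PreFock.word q w) = wordAnnihilation q f w := by
  unfold preAnnihilation
  exact (Finsupp.linearCombination_single ℂ 1 w).trans (one_smul _ _)

set_option linter.unusedSectionVars false in
theorem PreFock.induction {p : PreFock q H → Prop} (h0 : p 0)
    (hadd : ∀ ξ η, p ξ → p η → p (ξ + η)) (hw : ∀ (a : ℂ) w, p (a • PreFock.word q w))
    (ξ : PreFock q H) : p ξ := by
  refine Finsupp.induction_linear (motive := p) ξ h0 hadd fun w a => ?_
  have : (Finsupp.single w a : Word H →₀ ℂ) = a • (Finsupp.single w 1 : Word H →₀ ℂ) := by simp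
  rw [this]
  exact hw a w

theorem inner_preCreation_word (f : H) (v w : Word H) :
    inner ℂ (PreFock.word q ⟨v.1 + 1, Fin.cons f v.2⟩) (PreFock.word q w) =
      inner ℂ (PreFock.word q v) (wordAnnihilation q f w) := by
  obtain ⟨n, v⟩ := v
  obtain ⟨m, w⟩ := w
  cases m with
  | zero => simp [inner_word, wordInner_cons_nil, wordAnnihilation]
  | succ m =>
    simp only [inner_word, wordInner_cons, wordAnnihilation, inner_sum, inner_smul_right]
    push_cast
    rfl

theorem inner_preCreation (f : H) (ξ η : PreFock q H) :
    inner ℂ (preCreation q f ξ) η = inner ℂ ξ (preAnnihilation q f η) := by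
  induction ξ using PreFock.induction with
  | h0 => simp
  | hadd ξ ξ' h h' => simp [inner_add_left, h, h']
  | hw a v =>
    induction η using PreFock.induction with
    | h0 => simp
    | hadd η η' h h' => simp only [map_add, inner_add_right, h, h']
    | hw b w =>
      simp only [map_smul, inner_smul_left, inner_smul_right, preCreation_word,
        preAnnihilation_word, inner_preCreation_word]

/-- The `q`-commutation relation. -/
theorem preAnnihilation_preCreation (f g : H) (ξ : PreFock q H) :
    preAnnihilation q f (preCreation q g ξ) =
      ((q : ℝ) : ℂ) • preCreation q g (preAnnihilation q f ξ) + ((inner ℝ f g : ℝ) : ℂ) • ξ := by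
  induction ξ using PreFock.induction with
  | h0 => simp
  | hadd ξ ξ' h h' => simp only [map_add, h, h', smul_add]; abel
  | hw a v =>
    obtain ⟨n, v⟩ := v
    have key : wordAnnihilation q f ⟨n + 1, Fin.cons g v⟩ =
        ((q : ℝ) : ℂ) • preCreation q g (wordAnnihilation q f ⟨n, v⟩) +
          ((inner ℝ f g : ℝ) : ℂ) • PreFock.word q ⟨n, v⟩ := by
      rw [wordAnnihilation, Fin.sum_univ_succ, add_comm]
      congr 1
      · cases n with
        | zero => simp [wordAnnihilation]
        | succ n =>
          rw [wordAnnihilation, map_sum, Finset.smul_sum]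
          refine Finset.sum_congr rfl fun j _ => ?_
          rw [map_smul, preCreation_word, smul_smul]
          congr 1
          · simp only [Fin.val_succ, Fin.cons_succ]
            push_cast
            ring
          · congr 2
            funext i
            refine Fin.cases ?_ (fun i => ?_) i
            · simp [Fin.removeNth]
            · simp [Fin.removeNth]
      · simp
    simp only [map_smul, preCreation_word, preAnnihilation_word, key, smul_add]
    rw [smul_comm a, smul_comm a]

/-- The span of the words of length less than `N`. -/
def lowWords (H : Type u) (N : ℕ) : Submodule ℂ (PreFock q H) :=
  Submodule.span ℂ (PreFock.word q '' {w : Word H | w.1 < N})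

theorem exists_mem_lowWords (ξ : PreFock q H) : ∃ N, ξ ∈ lowWords q H N := by
  have mono : ∀ {N M : ℕ}, N ≤ M → lowWords q H N ≤ lowWords q H M := fun h =>
    Submodule.span_mono (Set.image_mono fun w hw => lt_of_lt_of_le hw h)
  induction ξ using PreFock.induction with
  | h0 => exact ⟨0, Submodule.zero_mem _⟩
  | hadd ξ η h h' =>
    obtain ⟨N, hN⟩ := h
    obtain ⟨M, hM⟩ := h'
    exact ⟨max N M, Submodule.add_mem _ (mono (le_max_left _ _) hN) (mono (le_max_right _ _) hM)⟩
  | hw a w =>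
    exact ⟨w.1 + 1, Submodule.smul_mem _ _ (Submodule.subset_span ⟨w, Nat.lt_succ_self _, rfl⟩)⟩

theorem preAnnihilation_mem (f : H) (N : ℕ) {ξ : PreFock q H} (h : ξ ∈ lowWords q H (N + 1)) :
    preAnnihilation q f ξ ∈ lowWords q H N := by
  refine Submodule.span_induction ?_ (by simp) ?_ ?_ h
  · rintro _ ⟨⟨n, w⟩, hw, rfl⟩
    rw [preAnnihilation_word]
    cases n with
    | zero => exact Submodule.zero_mem _
    | succ n =>
      exact Submodule.sum_mem _ fun j _ => Submodule.smul_mem _ _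
        (Submodule.subset_span ⟨_, Nat.succ_lt_succ_iff.1 (show n + 1 < N + 1 from hw), rfl⟩)
  · intro x y _ _ hx hy
    rw [map_add]
    exact Submodule.add_mem _ hx hy
  · intro a x _ hx
    rw [map_smul]
    exact Submodule.smul_mem _ _ hx

theorem norm_le_aux (f : H) {C : ℝ} (hC : 0 ≤ C) {ξ : PreFock q H}
    (h : ‖preCreation q f (preAnnihilation q f ξ)‖ ≤ C * ‖preAnnihilation q f ξ‖) :
    ‖preAnnihilation q f ξ‖ ≤ C * ‖ξ‖ := by
  have h1 : ‖preAnnihilation q f ξ‖ ^ 2 ≤ C * ‖preAnnihilation q f ξ‖ * ‖ξ‖ := by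
    rw [@norm_sq_eq_re_inner ℂ, ← inner_preCreation]
    exact (re_inner_le_norm _ _).trans (mul_le_mul_of_nonneg_right h (norm_nonneg _))
  rcases (norm_nonneg (preAnnihilation q f ξ)).eq_or_lt with h0 | h0
  · rw [← h0]
    positivity
  · nlinarith

theorem norm_preCreation_le_of_mem (f : H) {C : ℝ} (hC : 0 ≤ C)
    (hC2 : C ^ 2 = ‖f‖ ^ 2 / (1 - |(q : ℝ)|)) (N : ℕ) :
    ∀ ξ ∈ lowWords q H N, ‖preCreation q f ξ‖ ≤ C * ‖ξ‖ := by
  induction N with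
  | zero =>
    intro ξ hξ
    have : ξ = 0 := by simpa [lowWords] using hξ
    simp [this]
  | succ N ih =>
    intro ξ hξ
    have h1 := norm_le_aux q f hC (ih _ (preAnnihilation_mem q f N hξ))
    have h2 : ‖preCreation q f ξ‖ ^ 2 =
        (q : ℝ) * ‖preAnnihilation q f ξ‖ ^ 2 + ‖f‖ ^ 2 * ‖ξ‖ ^ 2 := by
      rw [@norm_sq_eq_re_inner ℂ, inner_preCreation, preAnnihilation_preCreation, inner_add_right,
        inner_smul_right, inner_smul_right, ← inner_conj_symm, inner_preCreation,
        real_inner_self_eq_norm_sq, inner_self_eq_norm_sq_to_K, inner_self_eq_norm_sq_to_K]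
      simp [← Complex.ofReal_pow]
    have hq : 0 < 1 - |(q : ℝ)| := by
      have := abs_lt.2 q.2
      linarith
    have h3 : ‖f‖ ^ 2 = C ^ 2 * (1 - |(q : ℝ)|) := by rw [hC2]; field_simp
    have h4 : ‖preAnnihilation q f ξ‖ ^ 2 ≤ (C * ‖ξ‖) ^ 2 := by gcongr
    have h5 : (q : ℝ) * ‖preAnnihilation q f ξ‖ ^ 2 ≤ |(q : ℝ)| * (C * ‖ξ‖) ^ 2 :=
      mul_le_mul (le_abs_self _) h4 (by positivity) (abs_nonneg _)
    have h6 : ‖preCreation q f ξ‖ ^ 2 ≤ (C * ‖ξ‖) ^ 2 := by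
      rw [h2, h3]
      nlinarith
    exact le_of_sq_le_sq h6 (by positivity)

theorem exists_bound (f : H) : ∃ C : ℝ, (∀ ξ : PreFock q H, ‖preCreation q f ξ‖ ≤ C * ‖ξ‖) ∧
    ∀ ξ : PreFock q H, ‖preAnnihilation q f ξ‖ ≤ C * ‖ξ‖ := by
  have hq : 0 < 1 - |(q : ℝ)| := by
    have := abs_lt.2 q.2
    linarith
  have h : ∀ ξ : PreFock q H,
      ‖preCreation q f ξ‖ ≤ √(‖f‖ ^ 2 / (1 - |(q : ℝ)|)) * ‖ξ‖ := fun ξ => by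
    obtain ⟨N, hN⟩ := exists_mem_lowWords q ξ
    exact norm_preCreation_le_of_mem q f (Real.sqrt_nonneg _)
      (Real.sq_sqrt (by positivity)) N ξ hN
  exact ⟨_, h, fun ξ => norm_le_aux q f (Real.sqrt_nonneg _) (h _)⟩

end PreFock

section QFock

variable (q : Set.Ioo (-1 : ℝ) 1)

/-- The `q`-Fock space over the real Hilbert space `H`: the Hausdorff completion of the span of the
words in the `q`-scalar product. -/
abbrev QFock (q : Set.Ioo (-1 : ℝ) 1) (H : Type u) [NormedAddCommGroup H]
    [InnerProductSpace ℝ H] : Type u :=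
  UniformSpace.Completion (PreFock q H)

/-- The elementary tensor `f₁ ⊗ ⋯ ⊗ fₙ` in the `q`-Fock space. -/
def tensor {n : ℕ} (f : Fin n → H) : QFock q H :=
  UniformSpace.Completion.coe' (PreFock.word q ⟨n, f⟩)

/-- The vacuum vector `Φ`, the tensor without factors. -/
def vacuum (H : Type u) [NormedAddCommGroup H] [InnerProductSpace ℝ H] : QFock q H :=
  tensor q (Fin.elim0 : Fin 0 → H)

theorem inner_tensor {n m : ℕ} (f : Fin n → H) (g : Fin m → H) :
    inner ℂ (tensor q f) (tensor q g) =
      ((∑ σ : Fin n ≃ Fin m, (q : ℝ) ^ inversions σ * ∏ j, inner ℝ (f j) (g (σ j)) : ℝ) : ℂ) := by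
  rw [tensor, tensor, UniformSpace.Completion.inner_coe, inner_word]
  rfl

/-- The creation operator `a*_f`, a bounded operator on the `q`-Fock space. -/
def creation (f : H) : QFock q H →L[ℂ] QFock q H :=
  ((preCreation q f).mkContinuousOfExistsBound
    ((exists_bound q f).imp fun _ h => h.1)).completion

/-- The annihilation operator `a_f`, a bounded operator on the `q`-Fock space. -/
def annihilation (f : H) : QFock q H →L[ℂ] QFock q H :=
  ((preAnnihilation q f).mkContinuousOfExistsBound
    ((exists_bound q f).imp fun _ h => h.2)).completion

theorem creation_tensor (f : H) {n : ℕ} (g : Fin n → H) :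
    creation q f (tensor q g) = tensor q (Fin.cons f g : Fin (n + 1) → H) := by
  rw [creation, tensor, ContinuousLinearMap.completion_apply_coe]
  exact congrArg _ (preCreation_word q f ⟨n, g⟩)

theorem annihilation_vacuum (f : H) : annihilation q f (vacuum q H) = 0 := by
  rw [annihilation, vacuum, tensor, ContinuousLinearMap.completion_apply_coe]
  exact (congrArg _ (preAnnihilation_word q f ⟨0, _⟩)).trans UniformSpace.Completion.coe_zero

theorem annihilation_tensor (f : H) {n : ℕ} (g : Fin (n + 1) → H) :
    annihilation q f (tensor q g) = ∑ j : Fin (n + 1),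
      (((q : ℝ) ^ (j : ℕ) * inner ℝ f (g j) : ℝ) : ℂ) • tensor q (j.removeNth g) := by
  rw [annihilation, tensor, ContinuousLinearMap.completion_apply_coe]
  refine (congrArg _ (preAnnihilation_word q f ⟨n + 1, g⟩)).trans ?_
  rw [wordAnnihilation, ← UniformSpace.Completion.coe_toComplL (𝕜 := ℂ), map_sum]
  simp only [map_smul]
  rfl

theorem inner_creation (f : H) (x y : QFock q H) :
    inner ℂ (creation q f x) y = inner ℂ x (annihilation q f y) := by
  induction x, y using UniformSpace.Completion.induction_on₂ with
  | hp => exact isClosed_eq (by fun_prop) (by fun_prop)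
  | ih ξ η =>
    rw [creation, annihilation, ContinuousLinearMap.completion_apply_coe,
      ContinuousLinearMap.completion_apply_coe, UniformSpace.Completion.inner_coe,
      UniformSpace.Completion.inner_coe]
    exact inner_preCreation q f ξ η

/-- The `q`-Gaussian variable `X_f = a_f + a*_f`. -/
def gaussian (f : H) : QFock q H →L[ℂ] QFock q H :=
  annihilation q f + creation q f

/-- The vacuum expectation `E(T) = ⟨Φ, T Φ⟩`. -/
def vacuumState (T : QFock q H →L[ℂ] QFock q H) : ℂ :=
  inner ℂ (vacuum q H) (T (vacuum q H))

/-- The algebra `𝒜` generated by the operators `X_f`, `f ∈ H`. -/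
def gaussianAlgebra (H : Type u) [NormedAddCommGroup H] [InnerProductSpace ℝ H] :
    Subalgebra ℂ (QFock q H →L[ℂ] QFock q H) :=
  Algebra.adjoin ℂ (Set.range (gaussian q : H → QFock q H →L[ℂ] QFock q H))

/-- `X_f` as an element of `𝒜`. -/
def gaussianVar (f : H) : gaussianAlgebra q H :=
  ⟨gaussian q f, Algebra.subset_adjoin ⟨f, rfl⟩⟩

/-- The subalgebra of `𝒜` generated by the identity and the `X_{f i}`. -/
def generatedBy {ι : Type*} (f : ι → H) : Subalgebra ℂ (gaussianAlgebra q H) :=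
  Algebra.adjoin ℂ (Set.range fun i => gaussianVar q (f i))

/-- A mapping `ℰ : 𝒜 → ℬ` is a conditional expectation with respect to the subalgebra `ℬ` if
`E(Y₁ X Y₂) = E(Y₁ ℰ(X) Y₂)` for all `X ∈ 𝒜` and `Y₁, Y₂ ∈ ℬ`. -/
def IsCondExp {q : Set.Ioo (-1 : ℝ) 1} (B : Subalgebra ℂ (gaussianAlgebra q H))
    (cE : gaussianAlgebra q H → B) : Prop :=
  ∀ (X : gaussianAlgebra q H) (Y₁ Y₂ : B),
    vacuumState q ((Y₁ * X * Y₂ : gaussianAlgebra q H) : QFock q H →L[ℂ] QFock q H) =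
      vacuumState q ((Y₁ * cE X * Y₂ : gaussianAlgebra q H) : QFock q H →L[ℂ] QFock q H)

/-- The von Neumann algebra generated by the self-adjoint operators `X_{f i}`: the double
commutant. -/
def vonNeumannGeneratedBy {ι : Type*} (f : ι → H) : Set (QFock q H →L[ℂ] QFock q H) :=
  Set.centralizer (Set.centralizer (Set.range fun i => gaussian q (f i)))

/-- `Z` is a conditional expectation of the single operator `X` with respect to `M`. -/
def IsCondExpOf {q : Set.Ioo (-1 : ℝ) 1} (M : Set (QFock q H →L[ℂ] QFock q H))
    (X Z : QFock q H →L[ℂ] QFock q H) : Prop :=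
  Z ∈ M ∧ ∀ Y₁ ∈ M, ∀ Y₂ ∈ M, vacuumState q (Y₁ * X * Y₂) = vacuumState q (Y₁ * Z * Y₂)

end QFock

/-- The orthogonal projection `P f₀` of `f₀` onto the span of the vectors `f₁, …, fₖ`. -/
def projSpan {ι : Type*} [Finite ι] (f : ι → H) (f₀ : H) : H :=
  haveI : FiniteDimensional ℝ (Submodule.span ℝ (Set.range f)) :=
    FiniteDimensional.span_of_finite ℝ (Set.finite_range f)
  (Submodule.span ℝ (Set.range f)).starProjection f₀

end QGauss

end

/-! Let K be the span of the f_i, P the projection onto K, and Γ = Γ(P) the second quantization f₁ ⊗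
⋯ ⊗ fₙ ↦ Pf₁ ⊗ ⋯ ⊗ Pfₙ. It is a self-adjoint idempotent which fixes Φ and commutes with X_f for f ∈
K, hence with the double commutant of the X_{f i}. If ΓXΓ = ZΓ, inserting Γ next to Φ and moving it
through Y₁, Y₂ gives E(Y₁XY₂) = E(Y₁ZY₂) (`vacuumState_eq_of_compress`). Conditional expectations
are therefore compressions by Γ.

Write f₀ = Pf₀ + g with g ⟂ K. Since a_gΓ = 0 and Γa*_g = 0, the compression of X_g is 0, and in
ΓX_g²Γ only Γa_g a*_gΓ survives. The q-commutation relation turns it into ‖g‖²Γ, because its q-term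
ends in a_gΓ. This is why q disappears and c = ‖g‖². See `compress_gaussian`,
`compress_gaussian_sq`, `compress_gaussian_sub_sq`.

Uniqueness needs Φ to be separating. Conjugation by the word reversal J yields right variables
JX_gJ, which commute with every X_f (`commute_gaussian_right`) and whose polynomials produce every
tensor from Φ (`exists_right_apply_vacuum`). An operator commuting with them and killing Φ is thus 0
(`eq_zero_of_apply_vacuum`), and testing with Y₁ = (Z - Z')* gives (Z - Z')Φ = 0.

The right variables also give existence on all of 𝒜. The vector XΦ is a finite combination of
tensors, so ΓXΦ = ZΦ for a polynomial Z in the X_f with f ∈ K, and commutation with the right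
variables spreads this to ΓXΓ = ZΓ (`exists_compress`). Finally, ⟨X_fΦ, X_gΦ⟩ = ⟨f, g⟩ makes the
X_{f j} independent when the f_j are, and the inverse Gram matrix gives the coefficients. -/

namespace QGauss

noncomputable section

variable {H : Type u} [NormedAddCommGroup H] [InnerProductSpace ℝ H]
variable (q : Set.Ioo (-1 : ℝ) 1)

/-! ### Operators on the `q`-Fock space determined by their values on tensors -/

variable {q} in
/-- Bounded operators which agree on elementary tensors are equal. -/
theorem ext_tensor {S T : QFock q H →L[ℂ] QFock q H}
    (h : ∀ (n : ℕ) (g : Fin n → H), S (tensor q g) = T (tensor q g)) : S = T := by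
  ext x
  induction x using UniformSpace.Completion.induction_on with
  | hp => exact isClosed_eq (by fun_prop) (by fun_prop)
  | ih ξ =>
    induction ξ using PreFock.induction with
    | h0 => rw [UniformSpace.Completion.coe_zero, map_zero, map_zero]
    | hadd ξ η h1 h2 => rw [UniformSpace.Completion.coe_add, map_add, map_add, h1, h2]
    | hw a w =>
      rw [UniformSpace.Completion.coe_smul, map_smul, map_smul]
      exact congrArg _ (h w.1 w.2)

variable {q} in
/-- A bounded operator is symmetric if it is symmetric on elementary tensors. -/
theorem inner_symm_of_tensor {T : QFock q H →L[ℂ] QFock q H}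
    (h : ∀ (n m : ℕ) (f : Fin n → H) (g : Fin m → H),
      inner ℂ (T (tensor q f)) (tensor q g) = inner ℂ (tensor q f) (T (tensor q g)))
    (x y : QFock q H) : inner ℂ (T x) y = inner ℂ x (T y) := by
  induction x, y using UniformSpace.Completion.induction_on₂ with
  | hp => exact isClosed_eq (by fun_prop) (by fun_prop)
  | ih ξ η =>
    induction ξ using PreFock.induction with
    | h0 => rw [UniformSpace.Completion.coe_zero, map_zero, inner_zero_left, inner_zero_left]
    | hadd ξ ξ' h1 h2 =>
      rw [UniformSpace.Completion.coe_add, map_add, inner_add_left, inner_add_left, h1, h2]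
    | hw a v =>
      rw [UniformSpace.Completion.coe_smul, map_smul, inner_smul_left, inner_smul_left]
      congr 1
      induction η using PreFock.induction with
      | h0 => rw [UniformSpace.Completion.coe_zero, map_zero, inner_zero_right, inner_zero_right]
      | hadd η η' h1 h2 =>
        rw [UniformSpace.Completion.coe_add, map_add, inner_add_right, inner_add_right, h1, h2]
      | hw b w =>
        rw [UniformSpace.Completion.coe_smul, map_smul, inner_smul_right, inner_smul_right]
        exact congrArg _ (h v.1 w.1 v.2 w.2)

/-- The linear extension of a map between words. -/
def preWordMap (T : Word H → Word H) : PreFock q H →ₗ[ℂ] PreFock q H :=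
  Finsupp.linearCombination ℂ fun w : Word H => PreFock.word q (T w)

set_option linter.unusedSectionVars false in
theorem preWordMap_word (T : Word H → Word H) (w : Word H) :
    preWordMap q T (PreFock.word q w) = PreFock.word q (T w) := by
  unfold preWordMap
  exact (Finsupp.linearCombination_single ℂ 1 w).trans (one_smul _ _)

theorem inner_preWordMap {T : Word H → Word H}
    (hT : ∀ v w, wordInner q (T v) w = wordInner q v (T w)) (ξ η : PreFock q H) :
    inner ℂ (preWordMap q T ξ) η = inner ℂ ξ (preWordMap q T η) := by
  induction ξ using PreFock.induction with
  | h0 => simp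
  | hadd ξ ξ' h h' => simp [inner_add_left, h, h']
  | hw a v =>
    induction η using PreFock.induction with
    | h0 => simp
    | hadd η η' h h' => simp only [map_add, inner_add_right, h, h']
    | hw b w =>
      simp only [map_smul, inner_smul_left, inner_smul_right, preWordMap_word, inner_word, hT]

set_option linter.unusedSectionVars false in
theorem preWordMap_thrice {T : Word H → Word H} (hT : ∀ w, T (T (T w)) = T w)
    (ξ : PreFock q H) :
    preWordMap q T (preWordMap q T (preWordMap q T ξ)) = preWordMap q T ξ := by
  induction ξ using PreFock.induction with
  | h0 => simp
  | hadd ξ ξ' h h' => simp only [map_add, h, h']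
  | hw a v => simp only [map_smul, preWordMap_word, hT]

/-- Symmetry and S³ = S give ‖S²ξ‖ = ‖Sξ‖, and then ‖Sξ‖² = ⟨S²ξ, ξ⟩ ≤ ‖Sξ‖‖ξ‖. The condition T³ = T
covers both reversal (T² = 1) and projections (T² = T). -/
theorem norm_preWordMap_le {T : Word H → Word H}
    (hT : ∀ v w, wordInner q (T v) w = wordInner q v (T w)) (hT' : ∀ w, T (T (T w)) = T w)
    (ξ : PreFock q H) : ‖preWordMap q T ξ‖ ≤ 1 * ‖ξ‖ := by
  set S := preWordMap q T
  have h1 : ‖S (S ξ)‖ ^ 2 = ‖S ξ‖ ^ 2 := by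
    rw [@norm_sq_eq_re_inner ℂ, @norm_sq_eq_re_inner ℂ, ← inner_preWordMap q hT,
      preWordMap_thrice q hT']
  have h2 : ‖S (S ξ)‖ = ‖S ξ‖ := by
    rwa [sq_eq_sq₀ (norm_nonneg _) (norm_nonneg _)] at h1
  have h3 : ‖S ξ‖ ^ 2 ≤ ‖S ξ‖ * ‖ξ‖ := by
    rw [@norm_sq_eq_re_inner ℂ, ← inner_preWordMap q hT, ← h2]
    exact re_inner_le_norm _ _
  rcases (norm_nonneg (S ξ)).eq_or_lt with h0 | h0
  · rw [← h0]
    positivity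
  · nlinarith

/-- The bounded operator on the `q`-Fock space acting on words as a given symmetric map `T` with
`T³ = T`. -/
def wordOperator (T : Word H → Word H)
    (hT : ∀ v w, wordInner q (T v) w = wordInner q v (T w)) (hT' : ∀ w, T (T (T w)) = T w) :
    QFock q H →L[ℂ] QFock q H :=
  ((preWordMap q T).mkContinuousOfExistsBound ⟨1, norm_preWordMap_le q hT hT'⟩).completion

theorem wordOperator_tensor (T : Word H → Word H)
    (hT : ∀ v w, wordInner q (T v) w = wordInner q v (T w)) (hT' : ∀ w, T (T (T w)) = T w)
    {n : ℕ} (g : Fin n → H) :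
    wordOperator q T hT hT' (tensor q g) = tensor q (T ⟨n, g⟩).2 := by
  rw [wordOperator, tensor, ContinuousLinearMap.completion_apply_coe]
  exact congrArg _ (preWordMap_word q T ⟨n, g⟩)

theorem star_wordOperator (T : Word H → Word H)
    (hT : ∀ v w, wordInner q (T v) w = wordInner q v (T w)) (hT' : ∀ w, T (T (T w)) = T w) :
    star (wordOperator q T hT hT') = wordOperator q T hT hT' := by
  rw [ContinuousLinearMap.star_eq_adjoint]
  symm
  rw [ContinuousLinearMap.eq_adjoint_iff]
  refine inner_symm_of_tensor fun n m f g => ?_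
  rw [wordOperator_tensor, wordOperator_tensor, tensor, tensor, tensor, tensor,
    UniformSpace.Completion.inner_coe, UniformSpace.Completion.inner_coe, inner_word, inner_word]
  exact congrArg _ (hT ⟨n, f⟩ ⟨m, g⟩)

/-! ### Word reversal -/

/-- The word read backwards. -/
def Word.reverse (w : Word H) : Word H := ⟨w.1, w.2 ∘ Fin.rev⟩

theorem starProjection_starProjection (K : Submodule ℝ H) [K.HasOrthogonalProjection] (x : H) :
    K.starProjection (K.starProjection x) = K.starProjection x :=
  Submodule.starProjection_eq_self_iff.2 (K.starProjection_apply_mem x)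

theorem inversions_rev {n m : ℕ} (σ : Fin n ≃ Fin m) :
    inversions (Fin.revPerm.trans (σ.trans Fin.revPerm)) = inversions σ := by
  refine Finset.card_bij' (fun p _ => (p.2.rev, p.1.rev)) (fun p _ => (p.2.rev, p.1.rev))
    ?_ ?_ ?_ ?_ <;> simp +contextual [Fin.rev_lt_rev]

/-- Substitute for σ its conjugate by the order reversal of the positions; this preserves the number
of inversions, since it sends an inverted pair to the mirrored pair. -/
theorem wordInner_reverse (q : ℝ) (v w : Word H) :
    wordInner q v.reverse w = wordInner q v w.reverse := by
  unfold wordInner Word.reverse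
  refine Fintype.sum_equiv ⟨fun σ => Fin.revPerm.trans (σ.trans Fin.revPerm),
    fun σ => Fin.revPerm.trans (σ.trans Fin.revPerm), fun σ => by ext; simp,
    fun σ => by ext; simp⟩ _ _ fun σ => ?_
  simp only [Equiv.coe_fn_mk, inversions_rev]
  congr 1
  refine Fintype.prod_equiv Fin.revPerm _ _ fun j => ?_
  simp

set_option linter.unusedSectionVars false in
theorem Word.reverse_reverse (w : Word H) : w.reverse.reverse = w := by
  simp [Word.reverse, Function.comp_def]

/-- The unitary `f₁ ⊗ ⋯ ⊗ fₙ ↦ fₙ ⊗ ⋯ ⊗ f₁`. -/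
def reversal (H : Type u) [NormedAddCommGroup H] [InnerProductSpace ℝ H] :
    QFock q H →L[ℂ] QFock q H :=
  wordOperator q Word.reverse (wordInner_reverse q) fun w => congrArg _ w.reverse_reverse

theorem reversal_tensor {n : ℕ} (g : Fin n → H) :
    reversal q H (tensor q g) = tensor q (g ∘ Fin.rev) :=
  wordOperator_tensor q _ _ _ g

theorem star_reversal : star (reversal q H) = reversal q H := star_wordOperator q _ _ _

theorem reversal_mul_reversal : reversal q H * reversal q H = 1 := by
  refine ext_tensor fun n g => ?_
  rw [mul_apply_eq_comp, reversal_tensor, reversal_tensor, Function.comp_assoc,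
    Fin.rev_involutive.comp_self]
  rfl

theorem reversal_vacuum : reversal q H (vacuum q H) = vacuum q H := by
  rw [vacuum, reversal_tensor]
  exact congrArg _ (Subsingleton.elim _ _)

/-! ### Second quantization of projections -/

/-- The second quantization `f₁ ⊗ ⋯ ⊗ fₙ ↦ P f₁ ⊗ ⋯ ⊗ P fₙ` of the projection `P` onto `K`. -/
def secondQuantization (K : Submodule ℝ H) [K.HasOrthogonalProjection] :
    QFock q H →L[ℂ] QFock q H :=
  wordOperator q (fun w => ⟨w.1, fun i => K.starProjection (w.2 i)⟩)
    (fun v w => by simp only [wordInner, Submodule.inner_starProjection_left_eq_right])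
    (fun w => by simp only [starProjection_starProjection])

variable (K : Submodule ℝ H) [K.HasOrthogonalProjection]

theorem secondQuantization_tensor {n : ℕ} (g : Fin n → H) :
    secondQuantization q K (tensor q g) = tensor q fun i => K.starProjection (g i) :=
  wordOperator_tensor q _ _ _ g

theorem star_secondQuantization : star (secondQuantization q K) = secondQuantization q K :=
  star_wordOperator q _ _ _

theorem secondQuantization_mul_self :
    secondQuantization q K * secondQuantization q K = secondQuantization q K := by
  refine ext_tensor fun n g => ?_
  simp [secondQuantization_tensor, starProjection_starProjection]

theorem secondQuantization_vacuum : secondQuantization q K (vacuum q H) = vacuum q H := by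
  rw [vacuum, secondQuantization_tensor]
  exact congrArg _ (Subsingleton.elim _ _)

theorem commute_secondQuantization_reversal :
    Commute (secondQuantization q K) (reversal q H) := by
  refine ext_tensor fun n g => ?_
  simp [secondQuantization_tensor, reversal_tensor, Function.comp_def]

/-! ### Creation and annihilation operators -/

theorem star_creation (f : H) : star (creation q f) = annihilation q f := by
  rw [← star_star (annihilation q f)]
  congr 1
  rw [ContinuousLinearMap.star_eq_adjoint, ContinuousLinearMap.eq_adjoint_iff]
  exact inner_creation q f

theorem star_annihilation (f : H) : star (annihilation q f) = creation q f := by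
  rw [← star_creation, star_star]

theorem star_gaussian (f : H) : star (gaussian q f) = gaussian q f := by
  rw [gaussian, star_add, star_creation, star_annihilation, add_comm]

theorem annihilation_add (f g : H) :
    annihilation q (f + g) = annihilation q f + annihilation q g := by
  refine ext_tensor fun n w => ?_
  cases n with
  | zero =>
    obtain rfl : w = Fin.elim0 := Subsingleton.elim _ _
    have h := fun f : H => annihilation_vacuum q f
    simp only [vacuum] at h
    simp [h]
  | succ n =>
    simp [annihilation_tensor, inner_add_left, mul_add, add_smul, Finset.sum_add_distrib]

theorem annihilation_smul (a : ℝ) (f : H) :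
    annihilation q (a • f) = (a : ℂ) • annihilation q f := by
  refine ext_tensor fun n w => ?_
  cases n with
  | zero =>
    obtain rfl : w = Fin.elim0 := Subsingleton.elim _ _
    have h := fun f : H => annihilation_vacuum q f
    simp only [vacuum] at h
    simp [h]
  | succ n =>
    simp only [annihilation_tensor, inner_smul_left, smul_apply,
      Finset.smul_sum, smul_smul]
    refine Finset.sum_congr rfl fun j _ => ?_
    congr 1
    push_cast
    simp
    ring

/-- On formal words additivity in the new letter holds only modulo null vectors. Passing to adjoints
reduces it to the annihilation operators, whose formula on tensors is visibly linear in f. -/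
theorem creation_add (f g : H) : creation q (f + g) = creation q f + creation q g := by
  simp only [← star_annihilation, annihilation_add, star_add]

theorem creation_smul (a : ℝ) (f : H) : creation q (a • f) = (a : ℂ) • creation q f := by
  simp only [← star_annihilation, annihilation_smul, star_smul]
  simp

/-- `f ↦ X_f` as a real linear map. -/
def gaussianLinear (H : Type u) [NormedAddCommGroup H] [InnerProductSpace ℝ H] :
    H →ₗ[ℝ] (QFock q H →L[ℂ] QFock q H) where
  toFun := gaussian q
  map_add' f g := by
    rw [gaussian, annihilation_add, creation_add, gaussian, gaussian]
    abel
  map_smul' a f := by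
    rw [gaussian, annihilation_smul, creation_smul, gaussian, ← smul_add]
    exact Complex.coe_smul _ _

theorem gaussian_sum_smul {ι : Type*} (s : Finset ι) (a : ι → ℝ) (f : ι → H) :
    gaussian q (∑ j ∈ s, a j • f j) = ∑ j ∈ s, (a j : ℂ) • gaussian q (f j) := by
  have h := map_sum (gaussianLinear q H) (fun j => a j • f j) s
  simp only [map_smul] at h
  exact h.trans (Finset.sum_congr rfl fun j _ => (Complex.coe_smul _ _).symm)

theorem annihilation_mul_creation (f g : H) :
    annihilation q f * creation q g =
      ((q : ℝ) : ℂ) • (creation q g * annihilation q f) + ((inner ℝ f g : ℝ) : ℂ) • 1 := by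
  refine ext_tensor fun n w => ?_
  have h := congrArg ((↑) : PreFock q H → QFock q H)
    (preAnnihilation_preCreation q f g (PreFock.word q ⟨n, w⟩))
  rw [UniformSpace.Completion.coe_add, UniformSpace.Completion.coe_smul,
    UniformSpace.Completion.coe_smul] at h
  simp only [mul_apply_eq_comp, add_apply,
    smul_apply, one_apply_eq_self, annihilation, creation,
    tensor, ContinuousLinearMap.completion_apply_coe]
  exact h

theorem secondQuantization_mul_creation (f : H) :
    secondQuantization q K * creation q f =
      creation q (K.starProjection f) * secondQuantization q K := by
  refine ext_tensor fun n g => ?_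
  simp only [mul_apply_eq_comp, creation_tensor, secondQuantization_tensor]
  congr 1
  funext i
  refine Fin.cases ?_ (fun i => ?_) i <;> simp

/-- The adjoint of the intertwining relation for creation; for f ⟂ K it makes the annihilation
operator vanish on the range of Γ. -/
theorem annihilation_mul_secondQuantization (f : H) :
    annihilation q f * secondQuantization q K =
      secondQuantization q K * annihilation q (K.starProjection f) := by
  have h := congrArg star (secondQuantization_mul_creation q K f)
  simpa only [star_mul, star_creation, star_secondQuantization] using h

theorem commute_secondQuantization_gaussian {f : H} (hf : f ∈ K) :
    Commute (secondQuantization q K) (gaussian q f) := by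
  have hP : K.starProjection f = f := Submodule.starProjection_eq_self_iff.2 hf
  have h1 := secondQuantization_mul_creation q K f
  have h2 := annihilation_mul_secondQuantization q K f
  rw [hP] at h1 h2
  rw [Commute, SemiconjBy, gaussian, mul_add, add_mul, h1, h2]

theorem annihilation_mul_secondQuantization_of_mem_orthogonal {f : H} (hf : f ∈ Kᗮ) :
    annihilation q f * secondQuantization q K = 0 := by
  have h0 : annihilation q (0 : H) = 0 := by simpa using annihilation_smul q 0 (0 : H)
  rw [annihilation_mul_secondQuantization, (Submodule.starProjection_apply_eq_zero_iff K).2 hf, h0,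
    mul_zero]

theorem secondQuantization_mul_creation_of_mem_orthogonal {f : H} (hf : f ∈ Kᗮ) :
    secondQuantization q K * creation q f = 0 := by
  have h := congrArg star (annihilation_mul_secondQuantization_of_mem_orthogonal q K hf)
  simpa only [star_mul, star_annihilation, star_secondQuantization, star_zero] using h

/-- Compression of `X_f` for `f` orthogonal to `K`. -/
theorem compress_gaussian_of_mem_orthogonal {f : H} (hf : f ∈ Kᗮ) :
    secondQuantization q K * gaussian q f * secondQuantization q K = 0 := by
  rw [gaussian, mul_add, secondQuantization_mul_creation_of_mem_orthogonal q K hf, add_zero,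
    mul_assoc, annihilation_mul_secondQuantization_of_mem_orthogonal q K hf, mul_zero]

/-- Compression of `X_f²` for `f` orthogonal to `K`. -/
theorem compress_gaussian_sq_of_mem_orthogonal {f : H} (hf : f ∈ Kᗮ) :
    secondQuantization q K * gaussian q f ^ 2 * secondQuantization q K =
      ((‖f‖ ^ 2 : ℝ) : ℂ) • secondQuantization q K := by
  have h1 : secondQuantization q K * gaussian q f = secondQuantization q K * annihilation q f := by
    rw [gaussian, mul_add, secondQuantization_mul_creation_of_mem_orthogonal q K hf, add_zero]
  have h2 : gaussian q f * secondQuantization q K = creation q f * secondQuantization q K := by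
    rw [gaussian, add_mul, annihilation_mul_secondQuantization_of_mem_orthogonal q K hf, zero_add]
  have h3 := annihilation_mul_secondQuantization_of_mem_orthogonal q K hf
  calc
    _ = (secondQuantization q K * gaussian q f) * (gaussian q f * secondQuantization q K) := by
      rw [sq]; simp only [mul_assoc]
    -- Of the four products in X_f², only annihilation after creation is not killed by one of the
    -- outer factors.
    _ = secondQuantization q K * (annihilation q f * creation q f) * secondQuantization q K := by
      rw [h1, h2]; simp only [mul_assoc]
    _ = ((‖f‖ ^ 2 : ℝ) : ℂ) • (secondQuantization q K * secondQuantization q K) := by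
      -- The q-term has the annihilation operator standing directly before Γ, so it drops out by
      -- `h3`.
      rw [annihilation_mul_creation, mul_add, add_mul, mul_smul_comm, mul_smul_comm,
        smul_mul_assoc, smul_mul_assoc, mul_one, mul_assoc, mul_assoc, h3, mul_zero, mul_zero,
        smul_zero, zero_add, real_inner_self_eq_norm_sq]
    _ = _ := by rw [secondQuantization_mul_self]

/-! ### The right `q`-Gaussian variables commute with the left ones -/

theorem reversal_creation_reversal_tensor (g : H) {n : ℕ} (w : Fin n → H) :
    (reversal q H * creation q g * reversal q H) (tensor q w) =
      tensor q (Fin.snoc w g : Fin (n + 1) → H) := by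
  simp only [mul_apply_eq_comp, reversal_tensor, creation_tensor]
  congr 1
  rw [Fin.cons_comp_rev, Function.comp_assoc, Fin.rev_involutive.comp_self]
  rfl

theorem commute_creation_right (f g : H) :
    Commute (creation q f) (reversal q H * creation q g * reversal q H) := by
  refine ext_tensor fun n w => ?_
  rw [mul_apply_eq_comp (creation q f), mul_apply_eq_comp _ (creation q f), creation_tensor,
    reversal_creation_reversal_tensor, reversal_creation_reversal_tensor, creation_tensor,
    Fin.cons_snoc_eq_snoc_cons]

theorem commute_annihilation_right (f g : H) :
    Commute (annihilation q f) (reversal q H * annihilation q g * reversal q H) := by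
  have h := congrArg star (commute_creation_right q f g).eq
  simp only [star_mul, star_creation, star_reversal, ← mul_assoc] at h
  simp only [Commute, SemiconjBy, ← mul_assoc]
  exact h.symm

theorem removeNth_castSucc_snoc {α : Type*} {n : ℕ} (j : Fin (n + 1)) (w : Fin (n + 1) → α)
    (g : α) : j.castSucc.removeNth (Fin.snoc w g : Fin (n + 2) → α) =
      (Fin.snoc (j.removeNth w) g : Fin (n + 1) → α) := by
  funext i
  refine Fin.lastCases ?_ (fun i => ?_) i
  · simp [Fin.removeNth]
  · simp [Fin.removeNth]

/-- After g is appended to w, the summands removing a letter of w cancel against the second product.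
What remains removes g itself, which stands at position n counted from 0. -/
theorem commutator_annihilation_right_tensor (f g : H) {n : ℕ} (w : Fin n → H) :
    (annihilation q f * (reversal q H * creation q g * reversal q H) -
      (reversal q H * creation q g * reversal q H) * annihilation q f) (tensor q w) =
      (((q : ℝ) ^ n * inner ℝ f g : ℝ) : ℂ) • tensor q w := by
  have hlast : ∀ {n : ℕ} (w : Fin n → H),
      (Fin.last n).removeNth (Fin.snoc w g : Fin (n + 1) → H) = w := fun w => by
    funext i
    simp [Fin.removeNth]
  rw [sub_apply, mul_apply_eq_comp,
    mul_apply_eq_comp _ (annihilation q f), reversal_creation_reversal_tensor,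
    annihilation_tensor, Fin.sum_univ_castSucc, sub_eq_iff_eq_add, add_comm]
  congr 1
  · simp [hlast]
  · cases n with
    | zero =>
      obtain rfl : w = Fin.elim0 := Subsingleton.elim _ _
      have h := annihilation_vacuum q f
      rw [vacuum] at h
      simp [h]
    | succ n =>
      rw [annihilation_tensor, map_sum]
      refine Finset.sum_congr rfl fun j _ => ?_
      rw [map_smul, reversal_creation_reversal_tensor, removeNth_castSucc_snoc]
      simp

/-- The creation-creation and annihilation-annihilation commutators vanish. The two mixed ones
cancel: each is, up to sign, multiplication by qⁿ⟨f, g⟩ on tensors of length n. -/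
theorem commute_gaussian_right (f g : H) :
    Commute (gaussian q f) (reversal q H * gaussian q g * reversal q H) := by
  have hJ := reversal_mul_reversal q (H := H)
  have h3 : annihilation q f * (reversal q H * creation q g * reversal q H) -
      (reversal q H * creation q g * reversal q H) * annihilation q f =
      (reversal q H * annihilation q g * reversal q H) * creation q f -
        creation q f * (reversal q H * annihilation q g * reversal q H) := by
    have e : (reversal q H * annihilation q g * reversal q H) * creation q f -
        creation q f * (reversal q H * annihilation q g * reversal q H) =
        reversal q H * (annihilation q g * (reversal q H * creation q f * reversal q H) -
        (reversal q H * creation q f * reversal q H) * annihilation q g) * reversal q H := by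
      simp only [mul_sub, sub_mul, ← mul_assoc, hJ, one_mul]
      simp only [mul_assoc, hJ, mul_one]
    rw [e]
    refine ext_tensor fun n w => ?_
    rw [commutator_annihilation_right_tensor, mul_apply_eq_comp,
      mul_apply_eq_comp, reversal_tensor, commutator_annihilation_right_tensor,
      map_smul, reversal_tensor, Function.comp_assoc, Fin.rev_involutive.comp_self,
      real_inner_comm]
    rfl
  have h1 := (commute_creation_right q f g).eq
  have h2 := (commute_annihilation_right q f g).eq
  rw [sub_eq_iff_eq_add] at h3
  have e : reversal q H * gaussian q g * reversal q H =
      reversal q H * annihilation q g * reversal q H +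
        reversal q H * creation q g * reversal q H := by
    rw [gaussian, mul_add, add_mul]
  rw [Commute, SemiconjBy, e, gaussian, mul_add, mul_add, add_mul, add_mul, add_mul, add_mul, h1,
    h2, h3]
  abel

end

end QGauss

namespace QGauss

noncomputable section

variable {H : Type u} [NormedAddCommGroup H] [InnerProductSpace ℝ H]
variable (q : Set.Ioo (-1 : ℝ) 1)

/-! ### Cyclicity of the vacuum -/

/-- Every tensor with letters in `K` is a polynomial in the variables `X_f`, `f ∈ K`, applied to
the vacuum. -/
theorem exists_mem_adjoin_apply_vacuum (K : Set H) {n : ℕ} (g : Fin n → H) (hg : ∀ i, g i ∈ K) :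
    ∃ L ∈ Algebra.adjoin ℂ (gaussian q '' K), L (vacuum q H) = tensor q g := by
  set B := Algebra.adjoin ℂ (gaussian q '' K) with hB
  let ev : (QFock q H →L[ℂ] QFock q H) →ₗ[ℂ] QFock q H :=
    (ContinuousLinearMap.apply ℂ (QFock q H) (vacuum q H)).toLinearMap
  -- The recursion calls words shorter by one and by two letters, so the induction runs over a bound
  -- for the length.
  suffices h : ∀ N n, n ≤ N → ∀ g : Fin n → H, (∀ i, g i ∈ K) →
      tensor q g ∈ B.toSubmodule.map ev by
    obtain ⟨L, hL, e⟩ := h n n le_rfl g hg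
    exact ⟨L, hL, e⟩
  intro N
  induction N with
  | zero =>
    intro n hn g _
    obtain rfl : n = 0 := by omega
    obtain rfl : g = Fin.elim0 := Subsingleton.elim _ _
    exact ⟨1, B.one_mem, rfl⟩
  | succ N ih =>
    intro n hn g hg
    cases n with
    | zero => exact ih 0 (Nat.zero_le _) g hg
    | succ n =>
      obtain ⟨L, hL, e⟩ := ih n (by omega) (Fin.tail g) fun i => hg i.succ
      -- Wick recursion: g₀ ⊗ w = X_{g₀}w - a_{g₀}w.
      have e1 : tensor q g = ev (gaussian q (g 0) * L) -
          annihilation q (g 0) (tensor q (Fin.tail g)) := by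
        have e2 : ev (gaussian q (g 0) * L) = gaussian q (g 0) (ev L) := rfl
        rw [e2, e, gaussian, add_apply, add_sub_cancel_left, creation_tensor, Fin.cons_self_tail]
      rw [e1]
      refine Submodule.sub_mem _ ⟨_, B.mul_mem (Algebra.subset_adjoin ⟨_, hg 0, rfl⟩) hL, rfl⟩ ?_
      cases n with
      | zero =>
        have h := annihilation_vacuum q (g 0)
        rw [vacuum] at h
        rw [Subsingleton.elim (Fin.tail g) Fin.elim0, h]
        exact Submodule.zero_mem _
      | succ n =>
        rw [annihilation_tensor]
        exact Submodule.sum_mem _ fun j _ => Submodule.smul_mem _ _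
          (ih n (by omega) _ fun i => hg _)

/-- The polynomials in the right `q`-Gaussian variables commute with the left variables. -/
theorem commute_of_mem_adjoin {T : QFock q H →L[ℂ] QFock q H} {K : Set H}
    (hT : ∀ f ∈ K, Commute T (reversal q H * gaussian q f * reversal q H))
    {L : QFock q H →L[ℂ] QFock q H} (hL : L ∈ Algebra.adjoin ℂ (gaussian q '' K)) :
    Commute T (reversal q H * L * reversal q H) := by
  have hJ := reversal_mul_reversal q (H := H)
  -- Moving J to the other side makes the condition on S membership in a centralizer, which is a
  -- subalgebra, so it suffices to check generators.
  have key : ∀ S : QFock q H →L[ℂ] QFock q H,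
      Commute T (reversal q H * S * reversal q H) ↔ Commute (reversal q H * T * reversal q H) S := by
    have h (T S : QFock q H →L[ℂ] QFock q H) (h : Commute T (reversal q H * S * reversal q H)) :
        Commute (reversal q H * T * reversal q H) S := by
      calc reversal q H * T * reversal q H * S
          = reversal q H * (T * (reversal q H * S * reversal q H)) * reversal q H := by
            simp only [mul_assoc, hJ, mul_one]
        _ = S * (reversal q H * T * reversal q H) := by
            rw [h.eq]
            simp only [← mul_assoc, hJ, one_mul]
    exact fun S => ⟨h T S, fun h' => (h S T h'.symm).symm⟩
  rw [key]
  have h : Algebra.adjoin ℂ (gaussian q '' K) ≤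
      Subalgebra.centralizer ℂ {reversal q H * T * reversal q H} := by
    refine Algebra.adjoin_le ?_
    rintro _ ⟨f, hf, rfl⟩
    rw [SetLike.mem_coe, Subalgebra.mem_centralizer_iff]
    rintro _ rfl
    exact ((key _).1 (hT f hf)).eq
  exact (Subalgebra.mem_centralizer_iff ℂ).1 (h hL) _ rfl

/-- J fixes the vacuum, so it is enough to produce the reversed word with left variables and then
apply J. -/
theorem exists_right_apply_vacuum (K : Set H) {n : ℕ} (g : Fin n → H) (hg : ∀ i, g i ∈ K) :
    ∃ L ∈ Algebra.adjoin ℂ (gaussian q '' K),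
      (reversal q H * L * reversal q H) (vacuum q H) = tensor q g := by
  obtain ⟨L, hL, e⟩ := exists_mem_adjoin_apply_vacuum q K (g ∘ Fin.rev) fun i => hg _
  refine ⟨L, hL, ?_⟩
  rw [mul_apply_eq_comp, mul_apply_eq_comp, reversal_vacuum, e, reversal_tensor,
    Function.comp_assoc, Fin.rev_involutive.comp_self]
  rfl

/-- The vacuum is separating for the operators which commute with the right variables. -/
theorem eq_zero_of_apply_vacuum {T : QFock q H →L[ℂ] QFock q H}
    (hT : ∀ f, Commute T (reversal q H * gaussian q f * reversal q H))
    (h0 : T (vacuum q H) = 0) : T = 0 := by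
  refine ext_tensor fun n g => ?_
  obtain ⟨L, hL, e⟩ := exists_right_apply_vacuum q Set.univ g fun _ => Set.mem_univ _
  rw [← e, ← mul_apply_eq_comp, (commute_of_mem_adjoin q (fun f _ => hT f) hL).eq,
    mul_apply_eq_comp, h0, map_zero, zero_apply]

theorem commute_right_of_mem_adjoin {T : QFock q H →L[ℂ] QFock q H}
    (hT : T ∈ Algebra.adjoin ℂ (Set.range (gaussian q : H → QFock q H →L[ℂ] QFock q H))) (f : H) :
    Commute T (reversal q H * gaussian q f * reversal q H) := by
  have h : Algebra.adjoin ℂ (Set.range (gaussian q : H → QFock q H →L[ℂ] QFock q H)) ≤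
      Subalgebra.centralizer ℂ {reversal q H * gaussian q f * reversal q H} := by
    refine Algebra.adjoin_le ?_
    rintro _ ⟨g, rfl⟩
    rw [SetLike.mem_coe, Subalgebra.mem_centralizer_iff]
    rintro _ rfl
    exact (commute_gaussian_right q g f).symm.eq
  exact ((Subalgebra.mem_centralizer_iff ℂ).1 (h hT) _ rfl).symm

/-- Polynomials in the variables preserve the algebraic Fock space. -/
theorem apply_vacuum_mem_span {T : QFock q H →L[ℂ] QFock q H}
    (hT : T ∈ Algebra.adjoin ℂ (Set.range (gaussian q : H → QFock q H →L[ℂ] QFock q H))) :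
    T (vacuum q H) ∈
      Submodule.span ℂ (Set.range fun w : Word H => (tensor q w.2 : QFock q H)) := by
  set V := Submodule.span ℂ (Set.range fun w : Word H => (tensor q w.2 : QFock q H)) with hV
  have ht : ∀ {n : ℕ} (g : Fin n → H), tensor q g ∈ V := fun g =>
    Submodule.subset_span ⟨⟨_, g⟩, rfl⟩
  -- Invariance of the whole span is what passes to products; the vacuum alone would not suffice.
  have h : ∀ x ∈ V, T x ∈ V := by
    induction hT using Algebra.adjoin_induction with
    | mem T hT =>
      obtain ⟨f, rfl⟩ := hT
      intro x hx
      refine Submodule.span_induction ?_ (by simp) ?_ ?_ hx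
      · rintro _ ⟨⟨n, g⟩, rfl⟩
        change gaussian q f (tensor q g) ∈ V
        rw [gaussian, add_apply, creation_tensor]
        refine V.add_mem ?_ (ht _)
        cases n with
        | zero =>
          have h := annihilation_vacuum q f
          rw [vacuum] at h
          rw [Subsingleton.elim g Fin.elim0, h]
          exact V.zero_mem
        | succ n =>
          rw [annihilation_tensor]
          exact V.sum_mem fun j _ => V.smul_mem _ (ht _)
      · intro x y _ _ hx hy
        rw [map_add]
        exact V.add_mem hx hy
      · intro a x _ hx
        rw [map_smul]
        exact V.smul_mem _ hx
    | algebraMap r =>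
      intro x hx
      rw [Algebra.algebraMap_eq_smul_one, smul_apply, one_apply_eq_self]
      exact V.smul_mem _ hx
    | add S T _ _ hS hT => exact fun x hx => V.add_mem (hS x hx) (hT x hx)
    | mul S T _ _ hS hT => exact fun x hx => hS _ (hT x hx)
  exact h _ (ht _)

/-! ### Compressions -/

/-- Every polynomial in the `q`-Gaussian variables is compressed by the second quantization of the
projection onto `K` to a polynomial in the variables indexed by `K`. -/
theorem exists_compress (K : Submodule ℝ H) [K.HasOrthogonalProjection]
    {X : QFock q H →L[ℂ] QFock q H}
    (hX : X ∈ Algebra.adjoin ℂ (Set.range (gaussian q : H → QFock q H →L[ℂ] QFock q H))) :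
    ∃ Z ∈ Algebra.adjoin ℂ (gaussian q '' (K : Set H)),
      secondQuantization q K * X * secondQuantization q K = Z * secondQuantization q K := by
  set B := Algebra.adjoin ℂ (gaussian q '' (K : Set H)) with hB
  let ev : (QFock q H →L[ℂ] QFock q H) →ₗ[ℂ] QFock q H :=
    (ContinuousLinearMap.apply ℂ (QFock q H) (vacuum q H)).toLinearMap
  have h1 : secondQuantization q K (X (vacuum q H)) ∈ B.toSubmodule.map ev := by
    refine Submodule.span_induction (p := fun x _ => secondQuantization q K x ∈
      B.toSubmodule.map ev) ?_ (by rw [map_zero]; exact Submodule.zero_mem _) ?_ ?_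
      (apply_vacuum_mem_span q hX)
    · rintro _ ⟨⟨n, g⟩, rfl⟩
      obtain ⟨L, hL, e⟩ := exists_mem_adjoin_apply_vacuum q (K : Set H)
        (fun i => K.starProjection (g i)) fun i => K.starProjection_apply_mem _
      exact ⟨L, hL, e.trans (secondQuantization_tensor q K g).symm⟩
    · intro x y _ _ hx hy
      rw [map_add]
      exact Submodule.add_mem _ hx hy
    · intro a x _ hx
      rw [map_smul]
      exact Submodule.smul_mem _ _ hx
  obtain ⟨Z, hZ, e⟩ := h1
  refine ⟨Z, hZ, ?_⟩
  replace e : Z (vacuum q H) = secondQuantization q K (X (vacuum q H)) := e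
  have hZ' : Z ∈ Algebra.adjoin ℂ (Set.range (gaussian q : H → QFock q H →L[ℂ] QFock q H)) :=
    Algebra.adjoin_mono (Set.image_subset_range _ _) hZ
  -- Γ commutes only with right variables indexed by K. That is enough, because after the inner Γ
  -- only tensors with letters in K occur.
  have hΓ : ∀ f ∈ (K : Set H), Commute (secondQuantization q K)
      (reversal q H * gaussian q f * reversal q H) := fun f hf =>
    ((commute_secondQuantization_reversal q K).mul_right
      (commute_secondQuantization_gaussian q K hf)).mul_right
      (commute_secondQuantization_reversal q K)
  refine ext_tensor fun n g => ?_
  obtain ⟨L, hL, eL⟩ := exists_right_apply_vacuum q (K : Set H)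
    (fun i => K.starProjection (g i)) fun i => K.starProjection_apply_mem _
  have hL' : L ∈ Algebra.adjoin ℂ (gaussian q '' Set.univ) :=
    Algebra.adjoin_mono (Set.image_mono (Set.subset_univ _)) hL
  have cX := commute_of_mem_adjoin q (fun f _ => commute_right_of_mem_adjoin q hX f) hL'
  have cZ := commute_of_mem_adjoin q (fun f _ => commute_right_of_mem_adjoin q hZ' f) hL'
  have cΓ := commute_of_mem_adjoin q hΓ hL
  -- With R = JLJ the computation is ΓXRΦ = RΓXΦ = RZΦ = ZRΦ.
  rw [mul_apply_eq_comp, mul_apply_eq_comp Z, secondQuantization_tensor, ← eL,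
    ← mul_apply_eq_comp, ← mul_apply_eq_comp Z, (cΓ.mul_left cX).eq, cZ.eq,
    mul_apply_eq_comp, mul_apply_eq_comp _ Z, e, mul_apply_eq_comp (secondQuantization q K)]

variable (K : Submodule ℝ H) [K.HasOrthogonalProjection]

theorem gaussian_sub (f g : H) : gaussian q (f - g) = gaussian q f - gaussian q g :=
  (gaussianLinear q H).map_sub f g

/-- The component of f orthogonal to K is compressed to 0, and Γ commutes with the variable of the
component in K. -/
theorem compress_gaussian (f : H) :
    secondQuantization q K * gaussian q f * secondQuantization q K =
      gaussian q (K.starProjection f) * secondQuantization q K := by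
  have h := compress_gaussian_of_mem_orthogonal q K (K.sub_starProjection_mem_orthogonal f)
  rw [gaussian_sub, mul_sub, sub_mul, sub_eq_zero] at h
  rw [h, (commute_secondQuantization_gaussian q K (K.starProjection_apply_mem f)).eq, mul_assoc,
    secondQuantization_mul_self]

theorem compress_gaussian_sub_sq (f : H) :
    secondQuantization q K * (gaussian q f - gaussian q (K.starProjection f)) ^ 2 *
      secondQuantization q K =
        (((‖f‖ ^ 2 - ‖K.starProjection f‖ ^ 2 : ℝ) : ℂ) • 1) * secondQuantization q K := by
  have hg := K.sub_starProjection_mem_orthogonal f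
  have h0 : inner ℝ (K.starProjection f) (f - K.starProjection f) = 0 :=
    hg _ (K.starProjection_apply_mem f)
  have h1 := norm_add_sq_eq_norm_sq_add_norm_sq_real h0
  rw [add_sub_cancel] at h1
  rw [← gaussian_sub, compress_gaussian_sq_of_mem_orthogonal q K hg, smul_one_mul]
  congr 2
  linarith

theorem compress_gaussian_sq (f : H) :
    secondQuantization q K * gaussian q f ^ 2 * secondQuantization q K =
      (gaussian q (K.starProjection f) ^ 2 +
        ((‖f‖ ^ 2 - ‖K.starProjection f‖ ^ 2 : ℝ) : ℂ) • 1) * secondQuantization q K := by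
  have h := compress_gaussian_sub_sq q K f
  have h0 := compress_gaussian_of_mem_orthogonal q K (K.sub_starProjection_mem_orthogonal f)
  have hc := (commute_secondQuantization_gaussian q K (K.starProjection_apply_mem f)).eq
  rw [gaussian_sub] at h0
  generalize gaussian q f = X at *
  generalize gaussian q (K.starProjection f) = Y at *
  have hΓ := secondQuantization_mul_self q K
  generalize secondQuantization q K = Γ at *
  -- X and Y need not commute, so both mixed terms are kept. Each is killed by moving Γ past Y onto
  -- X - Y.
  have e : X ^ 2 = (X - Y) ^ 2 + Y * (X - Y) + (X - Y) * Y + Y ^ 2 := by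
    simp only [sq, mul_sub, sub_mul]
    abel
  have e1 : Γ * (Y * (X - Y)) * Γ = 0 := by
    rw [← mul_assoc, hc, mul_assoc, mul_assoc, ← mul_assoc Γ, h0, mul_zero]
  have e2 : Γ * ((X - Y) * Y) * Γ = 0 := by
    rw [mul_assoc, mul_assoc, ← hc, ← mul_assoc, ← mul_assoc, mul_assoc Γ, ← mul_assoc Γ, h0,
      zero_mul]
  have e3 : Γ * Y ^ 2 * Γ = Y ^ 2 * Γ := by
    have hc2 : Commute Γ (Y ^ 2) := Commute.pow_right hc 2
    rw [hc2.eq, mul_assoc, hΓ]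
  rw [e, mul_add, mul_add, mul_add, add_mul, add_mul, add_mul, h, e1, e2, e3, add_zero, add_zero,
    add_mul, add_comm]

/-! ### Conditional expectations -/

variable {K} in
theorem vacuumState_eq_of_compress {Y₁ Y₂ X Z : QFock q H →L[ℂ] QFock q H}
    (h₁ : Commute (secondQuantization q K) Y₁) (h₂ : Commute (secondQuantization q K) Y₂)
    (h : secondQuantization q K * X * secondQuantization q K = Z * secondQuantization q K) :
    vacuumState q (Y₁ * X * Y₂) = vacuumState q (Y₁ * Z * Y₂) := by
  have hΓ : ∀ x y : QFock q H, inner ℂ (secondQuantization q K x) y =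
      inner ℂ x (secondQuantization q K y) := fun x y => by
    conv_rhs => rw [← star_secondQuantization, ContinuousLinearMap.star_eq_adjoint,
      ContinuousLinearMap.adjoint_inner_right]
  have e : secondQuantization q K * (Y₁ * X * Y₂) * secondQuantization q K =
      Y₁ * Z * Y₂ * secondQuantization q K := by
    calc _ = (secondQuantization q K * Y₁) * X * (Y₂ * secondQuantization q K) := by
          simp only [mul_assoc]
      _ = Y₁ * (secondQuantization q K * X * secondQuantization q K) * Y₂ := by
          rw [h₁.eq, ← h₂.eq]; simp only [mul_assoc]
      _ = Y₁ * Z * Y₂ * secondQuantization q K := by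
          rw [h, mul_assoc _ Y₂, ← h₂.eq]; simp only [mul_assoc]
  have e' := DFunLike.congr_fun e (vacuum q H)
  rw [mul_apply_eq_comp, mul_apply_eq_comp, mul_apply_eq_comp _ (secondQuantization q K),
    secondQuantization_vacuum] at e'
  rw [vacuumState, vacuumState, ← e', ← hΓ, secondQuantization_vacuum]

/-- The hypothesis says that (Z - Z')Φ has norm zero, and the vacuum is separating. -/
theorem eq_of_vacuumState_eq {Z Z' : QFock q H →L[ℂ] QFock q H}
    (hZ : ∀ f, Commute (Z - Z') (reversal q H * gaussian q f * reversal q H))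
    (h : vacuumState q (star (Z - Z') * Z) = vacuumState q (star (Z - Z') * Z')) : Z = Z' := by
  rw [← sub_eq_zero] at h ⊢
  refine eq_zero_of_apply_vacuum q hZ ?_
  rw [vacuumState, vacuumState, ← inner_sub_right, ← sub_apply, ← mul_sub, mul_apply_eq_comp,
    ContinuousLinearMap.star_eq_adjoint, ContinuousLinearMap.adjoint_inner_right] at h
  exact inner_self_eq_zero.1 h

end

end QGauss

namespace QGauss

noncomputable section

variable {H : Type u} [NormedAddCommGroup H] [InnerProductSpace ℝ H]
variable (q : Set.Ioo (-1 : ℝ) 1)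

/-! ### Conditional expectations as compressions, for the polynomial and the von Neumann algebra -/

section Generated

variable {ι : Type*} (f : ι → H)

/-- The polynomials in the operators `X_{f i}`. -/
def gaussianPolynomials : Subalgebra ℂ (QFock q H →L[ℂ] QFock q H) :=
  Algebra.adjoin ℂ (Set.range fun i => gaussian q (f i))

/-- Transfers questions about a subalgebra of 𝒜 to bounded operators, where adjoints and commutants
are available. -/
theorem map_val_generatedBy :
    (generatedBy q f).map (gaussianAlgebra q H).val = gaussianPolynomials q f := by
  rw [generatedBy, AlgHom.map_adjoin, ← Set.range_comp]
  rfl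

variable {q f}

theorem coe_mem_gaussianPolynomials (Y : generatedBy q f) :
    ((Y : gaussianAlgebra q H) : QFock q H →L[ℂ] QFock q H) ∈ gaussianPolynomials q f := by
  rw [← map_val_generatedBy]
  exact ⟨_, Y.2, rfl⟩

theorem exists_coe_eq {T : QFock q H →L[ℂ] QFock q H} (hT : T ∈ gaussianPolynomials q f) :
    ∃ Y : generatedBy q f, ((Y : gaussianAlgebra q H) : QFock q H →L[ℂ] QFock q H) = T := by
  rw [← map_val_generatedBy] at hT
  obtain ⟨Y, hY, e⟩ := hT
  exact ⟨⟨Y, hY⟩, e⟩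

theorem star_mem_gaussianPolynomials {T : QFock q H →L[ℂ] QFock q H}
    (hT : T ∈ gaussianPolynomials q f) : star T ∈ gaussianPolynomials q f := by
  rw [← Subalgebra.mem_star_iff, gaussianPolynomials, Subalgebra.star_adjoin_comm]
  refine Algebra.adjoin_mono ?_ hT
  rintro _ ⟨i, rfl⟩
  rw [Set.mem_star, star_gaussian]
  exact ⟨i, rfl⟩

theorem gaussian_mem_gaussianPolynomials {g : H} (hg : g ∈ Submodule.span ℝ (Set.range f)) :
    gaussian q g ∈ gaussianPolynomials q f := by
  have h : Submodule.span ℝ (Set.range f) ≤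
      ((gaussianPolynomials q f).toSubmodule.restrictScalars ℝ).comap (gaussianLinear q H) := by
    rw [Submodule.span_le]
    rintro _ ⟨i, rfl⟩
    exact Algebra.subset_adjoin ⟨i, rfl⟩
  exact h hg

theorem gaussianPolynomials_subset_vonNeumannGeneratedBy :
    (gaussianPolynomials q f : Set (QFock q H →L[ℂ] QFock q H)) ⊆ vonNeumannGeneratedBy q f := by
  have h : gaussianPolynomials q f ≤ Subalgebra.centralizer ℂ
      (Set.centralizer (Set.range fun i => gaussian q (f i))) :=
    Algebra.adjoin_le Set.subset_centralizer_centralizer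
  exact h

theorem star_mem_vonNeumannGeneratedBy {T : QFock q H →L[ℂ] QFock q H}
    (hT : T ∈ vonNeumannGeneratedBy q f) : star T ∈ vonNeumannGeneratedBy q f := by
  intro S hS
  have hS' : star S ∈ Set.centralizer (Set.range fun i => gaussian q (f i)) := by
    rintro _ ⟨i, rfl⟩
    have h := congrArg star (hS _ ⟨i, rfl⟩)
    simp only [star_mul, star_gaussian] at h
    exact h.symm
  have h := congrArg star (hT _ hS')
  rw [star_mul, star_mul, star_star] at h
  exact h.symm

theorem sub_mem_vonNeumannGeneratedBy {S T : QFock q H →L[ℂ] QFock q H}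
    (hS : S ∈ vonNeumannGeneratedBy q f) (hT : T ∈ vonNeumannGeneratedBy q f) :
    S - T ∈ vonNeumannGeneratedBy q f := fun U hU => by
  rw [mul_sub, sub_mul, hS U hU, hT U hU]

theorem one_mem_vonNeumannGeneratedBy :
    (1 : QFock q H →L[ℂ] QFock q H) ∈ vonNeumannGeneratedBy q f :=
  Set.one_mem_centralizer

/-- The right variables lie in the commutant of the left ones, hence commute with the double
commutant. No density argument is needed. -/
theorem commute_right_of_mem_vonNeumannGeneratedBy {T : QFock q H →L[ℂ] QFock q H}
    (hT : T ∈ vonNeumannGeneratedBy q f) (g : H) :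
    Commute T (reversal q H * gaussian q g * reversal q H) := by
  refine (hT _ ?_).symm
  rintro _ ⟨i, rfl⟩
  exact commute_gaussian_right q (f i) g

theorem commute_secondQuantization_of_mem_vonNeumannGeneratedBy (K : Submodule ℝ H)
    [K.HasOrthogonalProjection] (hK : ∀ i, f i ∈ K) {T : QFock q H →L[ℂ] QFock q H}
    (hT : T ∈ vonNeumannGeneratedBy q f) : Commute (secondQuantization q K) T := by
  refine hT _ ?_
  rintro _ ⟨i, rfl⟩
  exact (commute_secondQuantization_gaussian q K (hK i)).symm

theorem mem_span_range (i : ι) : f i ∈ Submodule.span ℝ (Set.range f) :=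
  Submodule.subset_span ⟨i, rfl⟩

variable [(Submodule.span ℝ (Set.range f)).HasOrthogonalProjection]

/-- Conditional expectations with respect to the generated von Neumann algebra are compressions. -/
theorem isCondExpOf_iff {X Z : QFock q H →L[ℂ] QFock q H} (hZ : Z ∈ gaussianPolynomials q f)
    (h : secondQuantization q (Submodule.span ℝ (Set.range f)) * X *
      secondQuantization q (Submodule.span ℝ (Set.range f)) =
        Z * secondQuantization q (Submodule.span ℝ (Set.range f)))
    (Z' : QFock q H →L[ℂ] QFock q H) :
    IsCondExpOf (vonNeumannGeneratedBy q f) X Z' ↔ Z' = Z := by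
  have hZM := gaussianPolynomials_subset_vonNeumannGeneratedBy hZ
  have key : IsCondExpOf (vonNeumannGeneratedBy q f) X Z := ⟨hZM, fun Y₁ h₁ Y₂ h₂ =>
    vacuumState_eq_of_compress q
      (commute_secondQuantization_of_mem_vonNeumannGeneratedBy _ mem_span_range h₁)
      (commute_secondQuantization_of_mem_vonNeumannGeneratedBy _ mem_span_range h₂) h⟩
  refine ⟨fun h' => ?_, fun e => e ▸ key⟩
  have hd := sub_mem_vonNeumannGeneratedBy h'.1 hZM
  refine eq_of_vacuumState_eq q (commute_right_of_mem_vonNeumannGeneratedBy hd) ?_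
  -- The test pair is Y₁ = (Z' - Z)*, Y₂ = 1.
  have h1 := h'.2 _ (star_mem_vonNeumannGeneratedBy hd) 1 one_mem_vonNeumannGeneratedBy
  have h2 := key.2 _ (star_mem_vonNeumannGeneratedBy hd) 1 one_mem_vonNeumannGeneratedBy
  rw [h1] at h2
  simpa only [mul_one] using h2

/-- The values of a conditional expectation on `𝒜` are compressions. -/
theorem IsCondExp.coe_eq {cE : gaussianAlgebra q H → generatedBy q f} (hE : IsCondExp _ cE)
    {X : gaussianAlgebra q H} {Z : QFock q H →L[ℂ] QFock q H} (hZ : Z ∈ gaussianPolynomials q f)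
    (h : secondQuantization q (Submodule.span ℝ (Set.range f)) * X *
      secondQuantization q (Submodule.span ℝ (Set.range f)) =
        Z * secondQuantization q (Submodule.span ℝ (Set.range f))) :
    ((cE X : gaussianAlgebra q H) : QFock q H →L[ℂ] QFock q H) = Z := by
  have hd := sub_mem (coe_mem_gaussianPolynomials (cE X)) hZ
  have hM : ∀ {T}, T ∈ gaussianPolynomials q f → T ∈ vonNeumannGeneratedBy q f := fun hT =>
    gaussianPolynomials_subset_vonNeumannGeneratedBy hT
  refine eq_of_vacuumState_eq q (commute_right_of_mem_vonNeumannGeneratedBy (hM hd)) ?_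
  -- The adjoint of the difference is again a polynomial, so it is an admissible test element of the
  -- smaller algebra.
  obtain ⟨Y, hY⟩ := exists_coe_eq (star_mem_gaussianPolynomials hd)
  have h1 := hE X Y 1
  have h2 := (((isCondExpOf_iff hZ h Z).2 rfl).2 _
    (star_mem_vonNeumannGeneratedBy (hM hd)) 1 one_mem_vonNeumannGeneratedBy)
  rw [← hY] at h2 ⊢
  simp only [OneMemClass.coe_one, mul_one, MulMemClass.coe_mul] at h1 h2
  exact h1.symm.trans h2

/-- There is exactly one conditional expectation of `𝒜` onto the polynomials in the `X_{f i}`. -/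
theorem existsUnique_isCondExp :
    ∃! cE : gaussianAlgebra q H → generatedBy q f, IsCondExp _ cE := by
  have hex : ∀ X : gaussianAlgebra q H, ∃ Y : generatedBy q f,
      secondQuantization q (Submodule.span ℝ (Set.range f)) * X *
      secondQuantization q (Submodule.span ℝ (Set.range f)) =
        ((Y : gaussianAlgebra q H) : QFock q H →L[ℂ] QFock q H) *
          secondQuantization q (Submodule.span ℝ (Set.range f)) := by
    intro X
    obtain ⟨Z, hZ, e⟩ := exists_compress q (Submodule.span ℝ (Set.range f)) X.2
    -- The compression gives a polynomial in X_g for all g in the span; linearity of g ↦ X_g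
    -- rewrites it in the finitely or infinitely many given X_{f i}.
    have hZ' : Z ∈ gaussianPolynomials q f := by
      refine Algebra.adjoin_le ?_ hZ
      rintro _ ⟨g, hg, rfl⟩
      exact gaussian_mem_gaussianPolynomials hg
    obtain ⟨Y, rfl⟩ := exists_coe_eq hZ'
    exact ⟨Y, e⟩
  choose cE hcE using hex
  refine ⟨cE, fun X Y₁ Y₂ => ?_, fun cE' hE' => ?_⟩
  · have hM : ∀ Y : generatedBy q f, ((Y : gaussianAlgebra q H) : QFock q H →L[ℂ] QFock q H) ∈
        vonNeumannGeneratedBy q f := fun Y =>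
      gaussianPolynomials_subset_vonNeumannGeneratedBy (coe_mem_gaussianPolynomials Y)
    exact ((isCondExpOf_iff (coe_mem_gaussianPolynomials (cE X)) (hcE X) _).2 rfl).2 _ (hM Y₁) _
      (hM Y₂)
  · funext X
    exact Subtype.ext (Subtype.ext (hE'.coe_eq (coe_mem_gaussianPolynomials (cE X)) (hcE X)))

end Generated

/-! ### Regression coefficients, their uniqueness, and triplets -/

section Regression

variable {ι : Type*} [Fintype ι]

instance (f : ι → H) : FiniteDimensional ℝ (Submodule.span ℝ (Set.range f)) :=
  FiniteDimensional.span_of_finite ℝ (Set.finite_range f)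

theorem projSpan_mem (f : ι → H) (f₀ : H) :
    projSpan f f₀ ∈ Submodule.span ℝ (Set.range f) :=
  Submodule.starProjection_apply_mem _ _

theorem exists_projSpan_eq_sum (f : ι → H) (f₀ : H) :
    ∃ a : ι → ℝ, projSpan f f₀ = ∑ j, a j • f j :=
  ((Submodule.mem_span_range_iff_exists_fun ℝ).1 (projSpan_mem f f₀)).imp fun _ h => h.symm

/-- The hypotheses are the normal equations: the residual is orthogonal to every f_i, hence to their
span. -/
theorem projSpan_eq_of_inner_eq {f : ι → H} {f₀ : H} {a : ι → ℝ}
    (h : ∀ i, ∑ j, a j * inner ℝ (f i) (f j) = inner ℝ (f i) f₀) :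
    projSpan f f₀ = ∑ j, a j • f j := by
  refine Submodule.eq_starProjection_of_mem_of_inner_eq_zero
    (Submodule.sum_mem _ fun j _ => Submodule.smul_mem _ _ (mem_span_range j)) fun w hw => ?_
  refine Submodule.span_induction ?_ (inner_zero_right _) ?_ ?_ hw
  · rintro _ ⟨i, rfl⟩
    rw [real_inner_comm, inner_sub_right, inner_sum, ← h i, sub_eq_zero]
    exact Finset.sum_congr rfl fun j _ => (real_inner_smul_right _ _ _).symm
  · intro x y _ _ hx hy
    rw [inner_add_right, hx, hy, add_zero]
  · intro r x _ hx
    rw [inner_smul_right, hx, mul_zero]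

theorem norm_sq_projSpan {f : ι → H} {f₀ : H} {a : ι → ℝ}
    (h : projSpan f f₀ = ∑ j, a j • f j) :
    ‖projSpan f f₀‖ ^ 2 = ∑ j, a j * inner ℝ f₀ (f j) := by
  have h1 : inner ℝ (projSpan f f₀) (projSpan f f₀) = inner ℝ f₀ (projSpan f f₀) := by
    rw [← sub_eq_zero, ← inner_sub_left, ← neg_sub, inner_neg_left,
      neg_eq_zero]
    exact Submodule.starProjection_inner_eq_zero _ _ (projSpan_mem f f₀)
  rw [← real_inner_self_eq_norm_sq, h1, h, inner_sum]
  exact Finset.sum_congr rfl fun j _ => real_inner_smul_right _ _ _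

variable {q}

theorem coe_sum_smul_gaussianVar (f : ι → H) (a : ι → ℂ) :
    ((∑ j, a j • gaussianVar q (f j) : gaussianAlgebra q H) : QFock q H →L[ℂ] QFock q H) =
      ∑ j, a j • gaussian q (f j) := by
  rw [AddSubmonoidClass.coe_finsetSum]
  rfl

theorem sum_smul_gaussian_eq {f : ι → H} {f₀ : H} {a : ι → ℝ}
    (h : projSpan f f₀ = ∑ j, a j • f j) :
    ∑ j, (a j : ℂ) • gaussian q (f j) = gaussian q (projSpan f f₀) := by
  rw [h, gaussian_sum_smul]

theorem gaussian_projSpan_mem (f : ι → H) (f₀ : H) :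
    gaussian q (projSpan f f₀) ∈ gaussianPolynomials q f :=
  gaussian_mem_gaussianPolynomials (projSpan_mem f f₀)

theorem gaussian_projSpan_sq_add_mem (f : ι → H) (f₀ : H) (c : ℂ) :
    gaussian q (projSpan f f₀) ^ 2 + c • 1 ∈ gaussianPolynomials q f :=
  add_mem (pow_mem (gaussian_projSpan_mem f f₀) 2) (Subalgebra.smul_mem _ (one_mem _) c)

/-- Linear regression. -/
theorem IsCondExp.gaussianVar {f : ι → H} {cE : gaussianAlgebra q H → generatedBy q f}
    (hE : IsCondExp _ cE) {f₀ : H} {a : ι → ℝ} (h : projSpan f f₀ = ∑ j, a j • f j) :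
    (cE (gaussianVar q f₀) : gaussianAlgebra q H) = ∑ j, (a j : ℂ) • gaussianVar q (f j) := by
  refine Subtype.ext ?_
  rw [coe_sum_smul_gaussianVar, sum_smul_gaussian_eq h]
  exact hE.coe_eq (gaussian_projSpan_mem f f₀) (compress_gaussian q _ f₀)

/-- The conditional second moment. -/
theorem IsCondExp.gaussianVar_sq {f : ι → H} {cE : gaussianAlgebra q H → generatedBy q f}
    (hE : IsCondExp _ cE) {f₀ : H} {a : ι → ℝ} (h : projSpan f f₀ = ∑ j, a j • f j) :
    (cE (QGauss.gaussianVar q f₀ ^ 2) : gaussianAlgebra q H) =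
      (∑ j, (a j : ℂ) • QGauss.gaussianVar q (f j)) ^ 2 +
        ((‖f₀‖ ^ 2 - ‖projSpan f f₀‖ ^ 2 : ℝ) : ℂ) • 1 := by
  refine Subtype.ext ?_
  have e : (((∑ j, (a j : ℂ) • QGauss.gaussianVar q (f j)) ^ 2 +
        ((‖f₀‖ ^ 2 - ‖projSpan f f₀‖ ^ 2 : ℝ) : ℂ) • 1 : gaussianAlgebra q H) :
        QFock q H →L[ℂ] QFock q H) =
      gaussian q (projSpan f f₀) ^ 2 + ((‖f₀‖ ^ 2 - ‖projSpan f f₀‖ ^ 2 : ℝ) : ℂ) • 1 := by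
    rw [← sum_smul_gaussian_eq h, ← coe_sum_smul_gaussianVar]
    rfl
  rw [e]
  exact hE.coe_eq (gaussian_projSpan_sq_add_mem f f₀ _) (compress_gaussian_sq q _ f₀)

/-- The conditional variance is constant. -/
theorem IsCondExp.gaussianVar_sub_sq {f : ι → H} {cE : gaussianAlgebra q H → generatedBy q f}
    (hE : IsCondExp _ cE) (f₀ : H) :
    (cE ((QGauss.gaussianVar q f₀ - cE (QGauss.gaussianVar q f₀)) ^ 2) : gaussianAlgebra q H) =
      ((‖f₀‖ ^ 2 - ‖projSpan f f₀‖ ^ 2 : ℝ) : ℂ) • 1 := by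
  refine Subtype.ext (hE.coe_eq (Subalgebra.smul_mem _ (one_mem _) _) ?_)
  have e : (((QGauss.gaussianVar q f₀ - cE (QGauss.gaussianVar q f₀)) ^ 2 : gaussianAlgebra q H) :
      QFock q H →L[ℂ] QFock q H) = (gaussian q f₀ - gaussian q (projSpan f f₀)) ^ 2 := by
    rw [← hE.coe_eq (X := QGauss.gaussianVar q f₀) (gaussian_projSpan_mem f f₀)
      (compress_gaussian q _ f₀)]
    rfl
  rw [e]
  exact compress_gaussian_sub_sq q _ f₀

/-! ### Uniqueness of the coefficients -/

theorem inner_vacuum_vacuum : inner ℂ (vacuum q H) (vacuum q H) = 1 := by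
  rw [vacuum, inner_tensor]
  simp [inversions]

theorem inner_gaussian_vacuum (f g : H) :
    inner ℂ (gaussian q f (vacuum q H)) (gaussian q g (vacuum q H)) = ((inner ℝ f g : ℝ) : ℂ) := by
  have h : annihilation q f (creation q g (vacuum q H)) =
      ((inner ℝ f g : ℝ) : ℂ) • vacuum q H := by
    rw [← mul_apply_eq_comp, annihilation_mul_creation]
    simp [annihilation_vacuum]
  rw [gaussian, gaussian, add_apply, add_apply, annihilation_vacuum, annihilation_vacuum, zero_add,
    zero_add, inner_creation, h, inner_smul_right, inner_vacuum_vacuum, mul_one]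

/-- The variables of linearly independent vectors are linearly independent over `ℂ`. -/
theorem linearIndependent_gaussian {f : ι → H} (hf : LinearIndependent ℝ f) :
    LinearIndependent ℂ fun j => gaussian q (f j) := by
  rw [Fintype.linearIndependent_iff] at hf ⊢
  intro d hd
  have h1 : ∀ i, ∑ j, d j * ((inner ℝ (f i) (f j) : ℝ) : ℂ) = 0 := fun i => by
    have h := congrArg (fun T : QFock q H →L[ℂ] QFock q H =>
      inner ℂ (gaussian q (f i) (vacuum q H)) (T (vacuum q H))) hd
    simpa [sum_apply, inner_sum, inner_smul_right, inner_gaussian_vacuum]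
      using h
  -- The Gram matrix is real, so a complex null vector splits into real and imaginary null vectors,
  -- and real ones vanish by independence.
  have h2 : ∀ b : ι → ℝ, (∀ i, ∑ j, b j * inner ℝ (f i) (f j) = 0) → ∀ i, b i = 0 := by
    refine fun b hb => hf b ?_
    rw [← inner_self_eq_zero (𝕜 := ℝ), sum_inner]
    refine Finset.sum_eq_zero fun i _ => ?_
    rw [real_inner_smul_left, inner_sum]
    simp only [real_inner_smul_right, hb, mul_zero]
  intro i
  refine Complex.ext (h2 (fun j => (d j).re) (fun i => ?_) i)
    (h2 (fun j => (d j).im) (fun i => ?_) i)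
  · simpa using congrArg Complex.re (h1 i)
  · simpa using congrArg Complex.im (h1 i)

/-- The regression coefficients and the residual variance as functions of the covariance
matrix. -/
def regressionCoeff (k : ℕ) (C : Matrix (Fin (k + 1)) (Fin (k + 1)) ℝ) : (Fin k → ℝ) × ℝ :=
  let a := (C.submatrix Fin.succ Fin.succ)⁻¹.mulVec fun i => C i.succ 0
  (a, C 0 0 - ∑ j, a j * C 0 j.succ)

/-- Independence makes the Gram matrix positive definite, hence invertible, and its inverse solves
the normal equations. -/
theorem projSpan_eq_regressionCoeff {k : ℕ} {f : Fin (k + 1) → H}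
    (hf : LinearIndependent ℝ fun j : Fin k => f j.succ) :
    projSpan (fun j : Fin k => f j.succ) (f 0) =
      ∑ j, (regressionCoeff k (Matrix.of fun i j => inner ℝ (f i) (f j))).1 j • f j.succ := by
  have hM := (Matrix.posDef_gram_of_linearIndependent hf).isUnit
  rw [Matrix.isUnit_iff_isUnit_det] at hM
  refine projSpan_eq_of_inner_eq fun i => ?_
  have h := congrFun (Matrix.mulVec_mulVec (fun i : Fin k => inner ℝ (f i.succ) (f 0))
    (Matrix.gram ℝ fun j : Fin k => f j.succ) (Matrix.gram ℝ fun j : Fin k => f j.succ)⁻¹) i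
  rw [Matrix.mul_nonsing_inv _ hM, Matrix.one_mulVec] at h
  refine Eq.trans (Finset.sum_congr rfl fun j _ => mul_comm _ _) h

theorem regressionCoeff_snd {k : ℕ} {f : Fin (k + 1) → H}
    (hf : LinearIndependent ℝ fun j : Fin k => f j.succ) :
    (regressionCoeff k (Matrix.of fun i j => inner ℝ (f i) (f j))).2 =
      ‖f 0‖ ^ 2 - ‖projSpan (fun j : Fin k => f j.succ) (f 0)‖ ^ 2 := by
  rw [norm_sq_projSpan (projSpan_eq_regressionCoeff hf), ← real_inner_self_eq_norm_sq]
  rfl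

theorem IsCondExp.coeff_iff {k : ℕ} {f : Fin (k + 1) → H}
    (hf : LinearIndependent ℝ fun j : Fin k => f j.succ)
    {cE : gaussianAlgebra q H → generatedBy q (fun j : Fin k => f j.succ)} (hE : IsCondExp _ cE)
    (a : Fin k → ℂ) (c : ℂ) :
    ((cE (QGauss.gaussianVar q (f 0)) : gaussianAlgebra q H) =
        ∑ j, a j • QGauss.gaussianVar q (f j.succ) ∧
      (cE (QGauss.gaussianVar q (f 0) ^ 2) : gaussianAlgebra q H) =
        (∑ j, a j • QGauss.gaussianVar q (f j.succ)) ^ 2 + c • 1) ↔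
    ((∀ j, a j = ((regressionCoeff k (Matrix.of fun i j => inner ℝ (f i) (f j))).1 j : ℝ)) ∧
      c = ((regressionCoeff k (Matrix.of fun i j => inner ℝ (f i) (f j))).2 : ℝ)) := by
  have hP := projSpan_eq_regressionCoeff hf
  rw [hE.gaussianVar hP, hE.gaussianVar_sq hP, regressionCoeff_snd hf]
  generalize (regressionCoeff k (Matrix.of fun i j => inner ℝ (f i) (f j))).1 = b
  constructor
  · rintro ⟨h1, h2⟩
    -- The linear equation makes the two squares equal, so the second equation compares only the
    -- constants.
    rw [h1] at h2
    have h1' := congrArg Subtype.val h1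
    rw [coe_sum_smul_gaussianVar (q := q) (fun j : Fin k => f j.succ),
      coe_sum_smul_gaussianVar (q := q) (fun j : Fin k => f j.succ)] at h1'
    have : Nontrivial (gaussianAlgebra q H) := by
      refine ⟨1, 0, fun h => ?_⟩
      have h' : vacuum q H = 0 :=
        congrArg (fun T : gaussianAlgebra q H => T.1 (vacuum q H)) h
      have h0 := inner_vacuum_vacuum (q := q) (H := H)
      rw [h', inner_zero_left] at h0
      exact zero_ne_one h0
    refine ⟨fun j => ?_, (smul_left_injective ℂ one_ne_zero (add_left_cancel h2)).symm⟩
    exact (congrFun ((linearIndependent_gaussian hf).fintypeLinearCombination_injective h1') j).symm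
  · rintro ⟨h1, rfl⟩
    simp only [h1, and_self]

/-! ### Triplets -/

/-- This is the Gram determinant of two independent unit vectors. -/
theorem one_sub_inner_sq_pos {f h : H} (hf : ‖f‖ = 1) (hh : ‖h‖ = 1)
    (hi : LinearIndependent ℝ ![f, h]) : 0 < 1 - inner ℝ f h ^ 2 := by
  have hd := (Matrix.posDef_gram_of_linearIndependent hi).det_pos
  rw [Matrix.det_fin_two] at hd
  simp only [Matrix.gram_apply, Matrix.cons_val_zero, Matrix.cons_val_one,
    real_inner_self_eq_norm_sq, hf, hh, real_inner_comm f h] at hd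
  linarith

theorem projSpan_pair {f g h : H} (hf : ‖f‖ = 1) (hh : ‖h‖ = 1)
    (hi : LinearIndependent ℝ ![f, h]) :
    projSpan ![f, h] g = ∑ j, (![(inner ℝ f g - inner ℝ g h * inner ℝ f h) / (1 - inner ℝ f h ^ 2),
      (inner ℝ g h - inner ℝ f g * inner ℝ f h) / (1 - inner ℝ f h ^ 2)] : Fin 2 → ℝ) j •
        (![f, h] : Fin 2 → H) j := by
  have h0 := (one_sub_inner_sq_pos hf hh hi).ne'
  refine projSpan_eq_of_inner_eq fun i => ?_
  fin_cases i
  · simp [Fin.sum_univ_two, hf]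
    field_simp
    ring
  · simp [Fin.sum_univ_two, hh, real_inner_comm f h, real_inner_comm g h]
    field_simp
    ring

/-- The quotient of the Gram determinants of f, g, h and of f, h is the squared distance from g to
the plane of f and h. -/
theorem det_div_eq {f g h : H} (hf : ‖f‖ = 1) (hh : ‖h‖ = 1)
    (hi : LinearIndependent ℝ ![f, h]) :
    (Matrix.of fun i j : Fin 3 => inner ℝ (![f, g, h] i) (![f, g, h] j)).det /
      (1 - inner ℝ f h ^ 2) = ‖g‖ ^ 2 - ‖projSpan ![f, h] g‖ ^ 2 := by
  have h0 := (one_sub_inner_sq_pos hf hh hi).ne'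
  rw [norm_sq_projSpan (projSpan_pair hf hh hi), Matrix.det_fin_three]
  simp [Fin.sum_univ_two, hf, hh, real_inner_comm f h, real_inner_comm g h, real_inner_comm f g]
  field_simp
  ring

end Regression

end

end QGauss

theorem mainTheorem4 :
    -- linear regression and constant conditional variance
    (∀ (H : Type u) [NormedAddCommGroup H] [InnerProductSpace ℝ H] [CompleteSpace H]
      (q : Set.Ioo (-1 : ℝ) 1) (k : ℕ) (f₀ : H) (f : Fin k → H),
      (∃! cE : QGauss.gaussianAlgebra q H → QGauss.generatedBy q f, QGauss.IsCondExp _ cE) ∧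
      (∃ a : Fin k → ℝ, QGauss.projSpan f f₀ = ∑ j, a j • f j) ∧
      ∀ (a : Fin k → ℝ) (c : ℝ), QGauss.projSpan f f₀ = ∑ j, a j • f j →
        c = ‖f₀‖ ^ 2 - ‖QGauss.projSpan f f₀‖ ^ 2 →
        (∀ cE : QGauss.gaussianAlgebra q H → QGauss.generatedBy q f, QGauss.IsCondExp _ cE →
          (cE (QGauss.gaussianVar q f₀) : QGauss.gaussianAlgebra q H) =
            ∑ j, (a j : ℂ) • QGauss.gaussianVar q (f j) ∧
          (cE (QGauss.gaussianVar q f₀ ^ 2) : QGauss.gaussianAlgebra q H) =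
            (∑ j, (a j : ℂ) • QGauss.gaussianVar q (f j)) ^ 2 + (c : ℂ) • 1 ∧
          (cE ((QGauss.gaussianVar q f₀ - cE (QGauss.gaussianVar q f₀)) ^ 2) :
            QGauss.gaussianAlgebra q H) = (c : ℂ) • 1) ∧
        -- the same formulas with respect to the generated von Neumann algebra
        (∀ Z, QGauss.IsCondExpOf (QGauss.vonNeumannGeneratedBy q f) (QGauss.gaussian q f₀) Z ↔
          Z = ∑ j, (a j : ℂ) • QGauss.gaussian q (f j)) ∧
        (∀ Z, QGauss.IsCondExpOf (QGauss.vonNeumannGeneratedBy q f)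
            (QGauss.gaussian q f₀ ^ 2) Z ↔
          Z = (∑ j, (a j : ℂ) • QGauss.gaussian q (f j)) ^ 2 + (c : ℂ) • 1) ∧
        (∀ Z, QGauss.IsCondExpOf (QGauss.vonNeumannGeneratedBy q f)
            ((QGauss.gaussian q f₀ - ∑ j, (a j : ℂ) • QGauss.gaussian q (f j)) ^ 2) Z ↔
          Z = (c : ℂ) • 1)) ∧
    -- for linearly independent `f₁, …, fₖ` the coefficients are unique and are a function of the
    -- covariance matrix of `f₀, f₁, …, fₖ` alone
    (∀ k : ℕ, ∃ coeff : Matrix (Fin (k + 1)) (Fin (k + 1)) ℝ → (Fin k → ℝ) × ℝ,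
      ∀ (H : Type u) [NormedAddCommGroup H] [InnerProductSpace ℝ H] [CompleteSpace H]
        (q : Set.Ioo (-1 : ℝ) 1) (f : Fin (k + 1) → H),
        LinearIndependent ℝ (fun j : Fin k => f j.succ) →
        ∀ cE : QGauss.gaussianAlgebra q H → QGauss.generatedBy q (fun j : Fin k => f j.succ),
          QGauss.IsCondExp _ cE → ∀ (a : Fin k → ℂ) (c : ℂ),
          ((cE (QGauss.gaussianVar q (f 0)) : QGauss.gaussianAlgebra q H) =
              ∑ j, a j • QGauss.gaussianVar q (f j.succ) ∧
            (cE (QGauss.gaussianVar q (f 0) ^ 2) : QGauss.gaussianAlgebra q H) =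
              (∑ j, a j • QGauss.gaussianVar q (f j.succ)) ^ 2 + c • 1) ↔
          ((∀ j, a j = ((coeff (Matrix.of fun i j => inner ℝ (f i) (f j))).1 j : ℝ)) ∧
            c = ((coeff (Matrix.of fun i j => inner ℝ (f i) (f j))).2 : ℝ))) ∧
    -- triplets
    (∀ (H : Type u) [NormedAddCommGroup H] [InnerProductSpace ℝ H] [CompleteSpace H]
      (q : Set.Ioo (-1 : ℝ) 1) (f g h : H), ‖f‖ = 1 → ‖h‖ = 1 → LinearIndependent ℝ ![f, h] →
      ∀ a b c : ℝ,
        a = (inner ℝ f g - inner ℝ g h * inner ℝ f h) / (1 - (inner ℝ f h) ^ 2) →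
        b = (inner ℝ g h - inner ℝ f g * inner ℝ f h) / (1 - (inner ℝ f h) ^ 2) →
        c = (Matrix.of fun i j : Fin 3 => inner ℝ (![f, g, h] i) (![f, g, h] j)).det /
          (1 - (inner ℝ f h) ^ 2) →
        0 ≤ c ∧ c = ‖g‖ ^ 2 - ‖QGauss.projSpan ![f, h] g‖ ^ 2 ∧
        ∀ cE : QGauss.gaussianAlgebra q H → QGauss.generatedBy q ![f, h], QGauss.IsCondExp _ cE →
          (cE (QGauss.gaussianVar q g) : QGauss.gaussianAlgebra q H) =
            (a : ℂ) • QGauss.gaussianVar q f + (b : ℂ) • QGauss.gaussianVar q h ∧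
          (cE (QGauss.gaussianVar q g ^ 2) : QGauss.gaussianAlgebra q H) =
            ((a : ℂ) • QGauss.gaussianVar q f + (b : ℂ) • QGauss.gaussianVar q h) ^ 2 +
              (c : ℂ) • 1) := by
  refine ⟨?_, ?_, ?_⟩
  · intro H _ _ _ q k f₀ f
    refine ⟨QGauss.existsUnique_isCondExp, QGauss.exists_projSpan_eq_sum f f₀, ?_⟩
    rintro a c h rfl
    -- The sum is the variable of the projection of f₀, so the formulas do not depend on the choice
    -- of the coefficients.
    rw [QGauss.sum_smul_gaussian_eq h]
    exact ⟨fun cE hE => ⟨hE.gaussianVar h, hE.gaussianVar_sq h, hE.gaussianVar_sub_sq f₀⟩,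
      QGauss.isCondExpOf_iff (QGauss.gaussian_projSpan_mem f f₀) (QGauss.compress_gaussian q _ f₀),
      QGauss.isCondExpOf_iff (QGauss.gaussian_projSpan_sq_add_mem f f₀ _)
        (QGauss.compress_gaussian_sq q _ f₀),
      QGauss.isCondExpOf_iff (Subalgebra.smul_mem _ (one_mem _) _)
        (QGauss.compress_gaussian_sub_sq q _ f₀)⟩
  · intro k
    refine ⟨QGauss.regressionCoeff k, ?_⟩
    intro H _ _ _ q f hf cE hE a c
    exact hE.coeff_iff hf a c
  · rintro H _ _ _ q f g h hf hh hi a b c rfl rfl rfl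
    have hP := QGauss.projSpan_pair (g := g) hf hh hi
    rw [QGauss.det_div_eq hf hh hi]
    refine ⟨?_, rfl, fun cE hE => ⟨?_, ?_⟩⟩
    · rw [sub_nonneg, sq_le_sq₀ (norm_nonneg _) (norm_nonneg _)]
      exact Submodule.norm_starProjection_apply_le _ g
    · refine (hE.gaussianVar hP).trans ?_
      rw [Fin.sum_univ_two]
      rfl
    · refine (hE.gaussianVar_sq hP).trans ?_
      rw [Fin.sum_univ_two]
      rfl
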